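/- For a symmetric positive definite matrix $B$ let $\lambda_{\min}(B),\lambda_{\max}(B)$ be its extreme eigenvalues and $\mathbf r(B)=\mathrm{tr}(B)/\lambda_{\max}(B)$ its effective rank; write $\vee,\wedge$ for maximum and minimum. A probability measure $\mu$ on $\mathbb R^d$ with mean $m$ and covariance $\Sigma$ is called sub-Gaussian with constant $K$ if $\mathbb E_{x\sim\mu}\exp(\langle\alpha,x-m\rangle)\le\exp(K^2\langle\alpha,\Sigma\alpha\rangle/2)$ for all $\alpha\in\mathbb R^d$. For all constants $0<c\le C<\infty$ and $K>0$ there are constants $C',C''>0$, depending only on $c,C,K$, such that the following holds for all $d\ge 1$, $n_1,n_2$ and $\mu_1,\mu_2$. Let $\mu_1,\mu_2$ be probability measures on $\mathbb R^d$, sub-Gaussian with constant $K$, with means $m_1,m_2$ and positive definite covariances $\Sigma_1,\Sigma_2$ such that $$c<\min_{j=1,2}\lambda_{\min}(\Sigma_j)\le\max_{j=1,2}\lambda_{\max}(\Sigma_j)\le C .$$ Assume that $n_1\ge d$, $n_1\ge C'\,\mathbf r(\Sigma_1)$ and $n_2\ge C'\,\mathbf r(\Sigma_2)$. Let $X_1,\dots,X_{n_1}$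 be i.i.d. with law $\mu_1$ and $Y_1,\dots,Y_{n_2}$ be i.i.d. with law $\mu_2$, let $\hat m_1,\hat m_2$ be the sample means and $\hat\Sigma_1,\hat\Sigma_2$ the sample covariances, $\hat\Sigma_1=\frac1{n_1}\sum_i(X_i-\hat m_1)(X_i-\hat m_1)^\top$ and likewise $\hat\Sigma_2$. Put $$T(x)=m_2+A(x-m_1),\qquad A=\Sigma_1^{-1/2}\bigl(\Sigma_1^{1/2}\Sigma_2\Sigma_1^{1/2}\bigr)^{1/2}\Sigma_1^{-1/2},$$ and, when $\hat\Sigma_1$ is nonsingular, let $\hat T(x)=\hat m_2+\hat A(x-\hat m_1)$, where $\hat A$ is given by the same formula with $\hat\Sigma_1,\hat\Sigma_2$ in place of $\Sigma_1,\Sigma_2$. Then for every $t>0$, with probability at least $1-e^{-t}-\frac1{n_1}$, the matrix $\hat\Sigma_1$ is nonsingular and $$\mathbb E_{x\sim\mu_1}\bigl\|T(x)-\hat T(x)\bigr\|\le C''\left(\sqrt{\frac{\mathbf r(\Sigma_1)}{n_1}}\vee\sqrt{\frac{\mathbf r(\Sigma_2)}{n_2}}\vee\sqrt{\frac{t}{n_1\wedge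 n_2}}\vee\frac{t}{n_1\wedge n_2}\right)\sqrt{\mathbf r(\Sigma_1)} ,$$ where the expectation is over $x$ only, with the samples fixed. -/

import Mathlib

open MeasureTheory ProbabilityTheory
open scoped MatrixOrder

namespace LinearMonge

/-- The expectation of a probability measure on `ℝ^d`. -/
noncomputable def mean {d : ℕ} (μ : Measure (EuclideanSpace ℝ (Fin d))) :
    EuclideanSpace ℝ (Fin d) :=
  ∫ x, x ∂μ

/-- The covariance matrix of a probability measure on `ℝ^d`. -/
noncomputable def covMatrix {d : ℕ} (μ : Measure (EuclideanSpace ℝ (Fin d))) :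
    Matrix (Fin d) (Fin d) ℝ :=
  Matrix.of fun i j => cov[fun x => x i, fun x => x j; μ]

/-- `μ` is sub-Gaussian with constant `K`: every one-dimensional marginal of `μ`, once centered,
has all exponential moments, and
`E exp (s ⟪α, x - m⟫) ≤ exp (K² s² ⟪α, Σ α⟫ / 2)` for all `s`, where `⟪α, Σ α⟫` is the variance of
`x ↦ ⟪α, x⟫`. For `K = 1` and invertible `Σ` this says that `Z = Σ^(-1/2) (x - m)` satisfies
`E exp ⟪α, Z⟫ ≤ exp (‖α‖² / 2)` for every `α`. -/
def IsSubGaussian {d : ℕ} (K : ℝ) (μ : Measure (EuclideanSpace ℝ (Fin d))) : Prop :=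
  ∀ α : EuclideanSpace ℝ (Fin d),
    HasSubgaussianMGF (fun x => inner ℝ α (x - mean μ))
      (Real.toNNReal (K ^ 2 * Var[fun x => inner ℝ α x; μ])) μ

/-- The smallest eigenvalue of a symmetric matrix. -/
noncomputable def lambdaMin {d : ℕ} (B : Matrix (Fin d) (Fin d) ℝ) : ℝ :=
  sInf (spectrum ℝ B)

/-- The largest eigenvalue of a symmetric matrix. -/
noncomputable def lambdaMax {d : ℕ} (B : Matrix (Fin d) (Fin d) ℝ) : ℝ :=
  sSup (spectrum ℝ B)

/-- The effective rank `r(B) = tr(B) / λ_max(B)` of a positive definite matrix. -/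
noncomputable def effRank {d : ℕ} (B : Matrix (Fin d) (Fin d) ℝ) : ℝ :=
  B.trace / lambdaMax B

/-- `A = S₁^(-1/2) (S₁^(1/2) S₂ S₁^(1/2))^(1/2) S₁^(-1/2)`, with the positive semidefinite
square root of matrices. -/
noncomputable def mongeMatrix {d : ℕ} (S₁ S₂ : Matrix (Fin d) (Fin d) ℝ) :
    Matrix (Fin d) (Fin d) ℝ :=
  (CFC.sqrt S₁)⁻¹ * CFC.sqrt (CFC.sqrt S₁ * S₂ * CFC.sqrt S₁) * (CFC.sqrt S₁)⁻¹

/-- The linear Monge map `x ↦ m₂ + A (x - m₁)` determined by means `m₁, m₂` and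
covariances `S₁, S₂`. -/
noncomputable def mongeMap {d : ℕ} (m₁ m₂ : EuclideanSpace ℝ (Fin d))
    (S₁ S₂ : Matrix (Fin d) (Fin d) ℝ) (x : EuclideanSpace ℝ (Fin d)) :
    EuclideanSpace ℝ (Fin d) :=
  m₂ + Matrix.toEuclideanCLM (𝕜 := ℝ) (mongeMatrix S₁ S₂) (x - m₁)

/-- The empirical mean of a sample of size `n`. -/
noncomputable def empMean {d n : ℕ} (x : Fin n → EuclideanSpace ℝ (Fin d)) :
    EuclideanSpace ℝ (Fin d) :=
  (n : ℝ)⁻¹ • ∑ k, x k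

/-- The empirical covariance matrix `(1/n) ∑ₖ (xₖ - m̂) (xₖ - m̂)ᵀ` of a sample of size `n`. -/
noncomputable def empCov {d n : ℕ} (x : Fin n → EuclideanSpace ℝ (Fin d)) :
    Matrix (Fin d) (Fin d) ℝ :=
  Matrix.of fun i j => (n : ℝ)⁻¹ * ∑ k, (x k i - empMean x i) * (x k j - empMean x j)

/-- The population linear Monge map `T` between `μ₁` and `μ₂`. -/
noncomputable def popMap {d : ℕ} (μ₁ μ₂ : Measure (EuclideanSpace ℝ (Fin d))) :
    EuclideanSpace ℝ (Fin d) → EuclideanSpace ℝ (Fin d) :=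
  mongeMap (mean μ₁) (mean μ₂) (covMatrix μ₁) (covMatrix μ₂)

/-- The empirical linear Monge map `T̂` computed from two samples. -/
noncomputable def empMap {d n₁ n₂ : ℕ} (x : Fin n₁ → EuclideanSpace ℝ (Fin d))
    (y : Fin n₂ → EuclideanSpace ℝ (Fin d)) :
    EuclideanSpace ℝ (Fin d) → EuclideanSpace ℝ (Fin d) :=
  mongeMap (empMean x) (empMean y) (empCov x) (empCov y)

/-- The divergence `d(T, T') = E_{x ∼ μ} ‖T x - T' x‖`. -/
noncomputable def mapDist {d : ℕ} (μ : Measure (EuclideanSpace ℝ (Fin d)))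
    (T T' : EuclideanSpace ℝ (Fin d) → EuclideanSpace ℝ (Fin d)) : ℝ :=
  ∫ x, ‖T x - T' x‖ ∂μ

end LinearMonge

/-! The matrix `A` of the linear Monge map is a positive semidefinite solution of the Riccati
equation `A S₁ A = S₂`, and its stability is read off that equation rather than off the square
roots. If `A' S₁' A' = S₂'`, then `A' S₁' A' - A S₁' A = (S₂' - S₂) - A (S₁' - S₁) A`, and the left
side is `D S₁' A' + A S₁' D` with `D = A' - A`. Testing at a top eigenvector of `S₁'^(1/2) D
S₁'^(1/2)` bounds `D` (`norm_sub_le_of_riccati`, `norm_mongeMatrix_sub_le`). This needs lower bounds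
on `A` and `S₁'` only: `S₂'` may be singular, so only the first sample has to be well conditioned
and only `1/n₁` is lost in probability.

The eigenvalue bounds make the effective rank comparable to `d`, so dimensional concentration
suffices: with `η = (d + s)/n`, sample means deviate by `O(√η)` and sample covariances by `O(max √η
η)` outside probability `3 exp(-s)` (`exists_forall_measure_deviation_le`). A norm that is large is
large in all directions of a small ball, so integrating exponential moments over directions replaces
a net.

Taking `s = t + log 6` for both samples gives the rate; taking `s = ε n₁` for the first keeps the
empirical covariance above `c/2`. A union bound over these three events concludes. -/

namespace LinearMonge

/-! ### Perturbation of the Riccati equation for symmetric operators -/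

section Operators

variable {E : Type*} [NormedAddCommGroup E] [InnerProductSpace ℝ E]

/-- A symmetric operator on a nontrivial finite-dimensional space has a unit eigenvector whose
eigenvalue has the operator norm as its absolute value. -/
theorem exists_unit_eigenvector_abs_eq_norm [FiniteDimensional ℝ E] [Nontrivial E] (T : E →L[ℝ] E)
    (hT : ∀ x y, inner ℝ (T x) y = inner ℝ x (T y)) :
    ∃ u : E, ‖u‖ = 1 ∧ ∃ l : ℝ, T u = l • u ∧ |l| = ‖T‖ := by
  have hsym : (T : E →ₗ[ℝ] E).IsSymmetric := hT
  have hn : Module.finrank ℝ E = Module.finrank ℝ E := rfl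
  have hpos : 0 < Module.finrank ℝ E := Module.finrank_pos
  have : Nonempty (Fin (Module.finrank ℝ E)) := ⟨⟨0, hpos⟩⟩
  set b := hsym.eigenvectorBasis hn
  set e := hsym.eigenvalues hn
  have hb : ∀ i, T (b i) = e i • b i := fun i => hsym.apply_eigenvectorBasis hn i
  obtain ⟨i, -, hi⟩ := Finset.exists_max_image (Finset.univ) (fun i => |e i|)
    ⟨Classical.arbitrary _, Finset.mem_univ _⟩
  have hub : ‖b i‖ = 1 := b.orthonormal.1 i
  refine ⟨b i, hub, e i, hb i, le_antisymm ?_ ?_⟩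
  · have := T.le_opNorm (b i)
    rw [hb, norm_smul, hub, mul_one, mul_one, Real.norm_eq_abs] at this
    exact this
  · refine T.opNorm_le_bound (abs_nonneg _) fun x => ?_
    refine abs_le_of_sq_le_sq' ?_ (by positivity) |>.2
    rw [mul_pow, ← b.sum_sq_norm_inner_right, ← b.sum_sq_norm_inner_right x, Finset.mul_sum]
    refine Finset.sum_le_sum fun j _ => ?_
    rw [← hT, hb, inner_smul_left, norm_mul, mul_pow]
    gcongr
    simpa using hi j (Finset.mem_univ _)

/-- Lipschitz dependence on the right-hand side of the positive semidefinite solution `A` of the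
Riccati equation `A R² A = S`. -/
theorem norm_sub_le_of_riccati [FiniteDimensional ℝ E] [Nontrivial E] (A A' R : E →L[ℝ] E)
    (hA : ∀ x y, inner ℝ (A x) y = inner ℝ x (A y))
    (hA' : ∀ x y, inner ℝ (A' x) y = inner ℝ x (A' y))
    (hR : ∀ x y, inner ℝ (R x) y = inner ℝ x (R y)) {a b : ℝ} (ha : 0 < a) (hb : 0 < b)
    (hAa : ∀ x, a * ‖x‖ ^ 2 ≤ inner ℝ x (A x)) (hA'0 : ∀ x, 0 ≤ inner ℝ x (A' x))
    (hRb : ∀ x, b * ‖x‖ ^ 2 ≤ ‖R x‖ ^ 2) :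
    ‖A' - A‖ ≤ ‖A' * (R * R) * A' - A * (R * R) * A‖ / (a * b) := by
  set D := A' - A with hD
  set X := A' * (R * R) * A' - A * (R * R) * A with hX
  have hDs : ∀ x y, inner ℝ (D x) y = inner ℝ x (D y) := fun x y => by
    simp [hD, inner_sub_left, inner_sub_right, hA, hA']
  have hT : ∀ x y, inner ℝ ((R * D * R) x) y = inner ℝ x ((R * D * R) y) := fun x y => by
    simp [hR, hDs]
  obtain ⟨u, hu, l, hl, hlT⟩ := exists_unit_eigenvector_abs_eq_norm (R * D * R) hT
  have hl' : R (D (R u)) = l • u := hl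
  have hvpos : 0 < ‖R u‖ ^ 2 := lt_of_lt_of_le (by rw [hu]; simpa using hb) (hRb u)
  -- `X = D R² A' + A R² D`; since `R D R u = l u`, both terms at `R u` become multiples of `l`,
  -- with no cancellation because `A` and `A'` are nonnegative.
  have key : inner ℝ (R u) (X (R u)) = l * (inner ℝ (R u) (A' (R u)) + inner ℝ (R u) (A (R u))) := by
    have h1 : X (R u) = D (R (R (A' (R u)))) + A (R (R (D (R u)))) := by
      simp [hX, hD]
    rw [h1, inner_add_right, ← hDs, ← hR, hl', inner_smul_left, ← hR u, map_smul, map_smul,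
      inner_smul_right]
    simp only [conj_trivial]
    ring
  have hXn : |inner ℝ (R u) (X (R u))| ≤ ‖X‖ * ‖R u‖ ^ 2 := by
    calc _ ≤ ‖R u‖ * ‖X (R u)‖ := abs_real_inner_le_norm _ _
      _ ≤ ‖R u‖ * (‖X‖ * ‖R u‖) := by gcongr; exact X.le_opNorm _
      _ = _ := by ring
  have hTn : ‖R * D * R‖ * a ≤ ‖X‖ := by
    have h2 : a * ‖R u‖ ^ 2 ≤ inner ℝ (R u) (A' (R u)) + inner ℝ (R u) (A (R u)) := by
      linarith [hAa (R u), hA'0 (R u)]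
    rw [key, abs_mul, hlT, abs_of_nonneg (le_trans (by positivity) h2)] at hXn
    have h3 := (mul_le_mul_of_nonneg_left h2 (norm_nonneg (R * D * R))).trans hXn
    rw [← mul_assoc] at h3
    exact le_of_mul_le_mul_right h3 hvpos
  -- From `R D R` back to `D`: a top eigenvector of `D` is `R z` with `‖z‖² ≤ 1 / b`, and its
  -- eigenvalue is `⟪z, R D R z⟫`.
  obtain ⟨w, hw, m, hm, hmD⟩ := exists_unit_eigenvector_abs_eq_norm D hDs
  have hinj : Function.Injective R := by
    refine (injective_iff_map_eq_zero R).2 fun x hx => ?_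
    have := hRb x
    rw [hx, norm_zero] at this
    have h4 : ‖x‖ ^ 2 ≤ 0 := by nlinarith
    simpa using le_antisymm h4 (by positivity)
  obtain ⟨z, rfl⟩ := (LinearMap.injective_iff_surjective (f := (R : E →ₗ[ℝ] E))).1 hinj w
  change ‖R z‖ = 1 at hw
  change D (R z) = m • R z at hm
  have hz : b * ‖z‖ ^ 2 ≤ 1 := by simpa [hw] using hRb z
  have h5 : |m| ≤ ‖R * D * R‖ * ‖z‖ ^ 2 := by
    have h6 : m = inner ℝ z ((R * D * R) z) := by
      change m = inner ℝ z (R (D (R z)))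
      rw [← hR, hm, inner_smul_right, real_inner_self_eq_norm_sq, hw]; ring
    rw [h6]
    calc _ ≤ ‖z‖ * ‖(R * D * R) z‖ := abs_real_inner_le_norm _ _
      _ ≤ ‖z‖ * (‖R * D * R‖ * ‖z‖) := by gcongr; exact (R * D * R).le_opNorm _
      _ = _ := by ring
  rw [le_div_iff₀ (by positivity), ← hmD]
  calc |m| * (a * b) ≤ (‖R * D * R‖ * ‖z‖ ^ 2) * (a * b) := by gcongr
    _ = (‖R * D * R‖ * a) * (b * ‖z‖ ^ 2) := by ring
    _ ≤ ‖X‖ * 1 := by gcongr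
    _ = _ := mul_one _

end Operators

/-! ### Spectral bounds and stability of the Monge matrix -/

section Matrices

open Matrix

variable {d : ℕ}

theorem inner_toEuclideanCLM_left {B : Matrix (Fin d) (Fin d) ℝ} (hB : B.IsHermitian)
    (x y : EuclideanSpace ℝ (Fin d)) :
    inner ℝ (toEuclideanCLM (𝕜 := ℝ) B x) y = inner ℝ x (toEuclideanCLM (𝕜 := ℝ) B y) := by
  rw [real_inner_comm, inner_toEuclideanCLM, inner_toEuclideanCLM, dotProduct_mulVec,
    ← mulVec_transpose, dotProduct_comm]
  have : Bᵀ = B := hB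
  rw [this]

theorem inner_toEuclideanCLM_nonneg {B : Matrix (Fin d) (Fin d) ℝ} (hB : B.PosSemidef)
    (x : EuclideanSpace ℝ (Fin d)) : 0 ≤ inner ℝ x (toEuclideanCLM (𝕜 := ℝ) B x) := by
  rw [inner_toEuclideanCLM]
  simpa using hB.dotProduct_mulVec_nonneg x.ofLp

theorem le_inner_toEuclideanCLM_of_le_spectrum {B : Matrix (Fin d) (Fin d) ℝ}
    (hB : B.IsHermitian) {a : ℝ} (ha : ∀ e ∈ spectrum ℝ B, a ≤ e)
    (x : EuclideanSpace ℝ (Fin d)) :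
    a * ‖x‖ ^ 2 ≤ inner ℝ x (toEuclideanCLM (𝕜 := ℝ) B x) := by
  have h := (algebraMap_le_iff_le_spectrum (a := B) (r := a) hB).2 ha
  have h' := inner_toEuclideanCLM_nonneg (Matrix.le_iff.1 h) x
  rw [map_sub, Algebra.algebraMap_eq_smul_one, map_smul, map_one] at h'
  simp only [_root_.sub_apply, _root_.smul_apply,
    one_apply_eq_self, inner_sub_right, inner_smul_right,
    real_inner_self_eq_norm_sq] at h'
  linarith

theorem inner_toEuclideanCLM_le_of_spectrum_le {B : Matrix (Fin d) (Fin d) ℝ}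
    (hB : B.IsHermitian) {a : ℝ} (ha : ∀ e ∈ spectrum ℝ B, e ≤ a)
    (x : EuclideanSpace ℝ (Fin d)) :
    inner ℝ x (toEuclideanCLM (𝕜 := ℝ) B x) ≤ a * ‖x‖ ^ 2 := by
  have h := (le_algebraMap_iff_spectrum_le (a := B) (r := a) hB).2 ha
  have h' := inner_toEuclideanCLM_nonneg (Matrix.le_iff.1 h) x
  rw [map_sub, Algebra.algebraMap_eq_smul_one, map_smul, map_one] at h'
  simp only [_root_.sub_apply, _root_.smul_apply,
    one_apply_eq_self, inner_sub_right, inner_smul_right,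
    real_inner_self_eq_norm_sq] at h'
  linarith

theorem lambdaMin_mul_le {B : Matrix (Fin d) (Fin d) ℝ} (hB : B.IsHermitian)
    (x : EuclideanSpace ℝ (Fin d)) :
    lambdaMin B * ‖x‖ ^ 2 ≤ inner ℝ x (toEuclideanCLM (𝕜 := ℝ) B x) :=
  le_inner_toEuclideanCLM_of_le_spectrum hB
    (fun _ he => csInf_le (finite_real_spectrum).bddBelow he) x

theorem le_lambdaMax_mul {B : Matrix (Fin d) (Fin d) ℝ} (hB : B.IsHermitian)
    (x : EuclideanSpace ℝ (Fin d)) :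
    inner ℝ x (toEuclideanCLM (𝕜 := ℝ) B x) ≤ lambdaMax B * ‖x‖ ^ 2 :=
  inner_toEuclideanCLM_le_of_spectrum_le hB
    (fun _ he => le_csSup (finite_real_spectrum).bddAbove he) x

theorem lambdaMin_mul_le_trace {B : Matrix (Fin d) (Fin d) ℝ} (hB : B.IsHermitian) :
    d * lambdaMin B ≤ B.trace := by
  rw [hB.trace_eq_sum_eigenvalues]
  calc (d : ℝ) * lambdaMin B = ∑ _i : Fin d, lambdaMin B := by simp
    _ ≤ _ := Finset.sum_le_sum fun i _ =>
      csInf_le (finite_real_spectrum).bddBelow (hB.eigenvalues_mem_spectrum_real i)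

theorem lambdaMin_le_lambdaMax (hd : 1 ≤ d) {B : Matrix (Fin d) (Fin d) ℝ} (hB : B.IsHermitian) :
    lambdaMin B ≤ lambdaMax B :=
  (csInf_le (finite_real_spectrum).bddBelow (hB.eigenvalues_mem_spectrum_real ⟨0, hd⟩)).trans
    (le_csSup (finite_real_spectrum).bddAbove (hB.eigenvalues_mem_spectrum_real ⟨0, hd⟩))

theorem posDef_of_le_inner {B : Matrix (Fin d) (Fin d) ℝ} (hB : B.IsHermitian) {a : ℝ} (ha : 0 < a)
    (h : ∀ x, a * ‖x‖ ^ 2 ≤ inner ℝ x (toEuclideanCLM (𝕜 := ℝ) B x)) : B.PosDef := by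
  refine PosDef.of_dotProduct_mulVec_pos hB fun x hx => ?_
  have h1 := h (WithLp.toLp 2 x)
  rw [inner_toEuclideanCLM] at h1
  have h2 : 0 < ‖WithLp.toLp 2 x‖ := norm_pos_iff.2 (by simpa using hx)
  refine lt_of_lt_of_le (by positivity) (h1.trans_eq (by simp))

theorem norm_toEuclideanCLM_le_of_abs_inner_le (hd : 1 ≤ d) {B : Matrix (Fin d) (Fin d) ℝ}
    (hB : B.IsHermitian) {a : ℝ}
    (h : ∀ x, |inner ℝ x (toEuclideanCLM (𝕜 := ℝ) B x)| ≤ a * ‖x‖ ^ 2) :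
    ‖toEuclideanCLM (𝕜 := ℝ) B‖ ≤ a := by
  have : Nonempty (Fin d) := ⟨⟨0, hd⟩⟩
  obtain ⟨u, hu, l, hl, hlB⟩ := exists_unit_eigenvector_abs_eq_norm (toEuclideanCLM (𝕜 := ℝ) B)
    (inner_toEuclideanCLM_left hB)
  have := h u
  rwa [hl, inner_smul_right, real_inner_self_eq_norm_sq, hu, one_pow, mul_one, mul_one, hlB] at this

theorem mongeMatrix_posSemidef {S₁ S₂ : Matrix (Fin d) (Fin d) ℝ} :
    (mongeMatrix S₁ S₂).PosSemidef := by
  have hR : (CFC.sqrt S₁).PosSemidef := nonneg_iff_posSemidef.1 (CFC.sqrt_nonneg _)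
  have hM : (CFC.sqrt (CFC.sqrt S₁ * S₂ * CFC.sqrt S₁)).PosSemidef :=
    nonneg_iff_posSemidef.1 (CFC.sqrt_nonneg _)
  have := hM.conjTranspose_mul_mul_same (CFC.sqrt S₁)⁻¹
  rwa [hR.inv.isHermitian.eq] at this

theorem isUnit_det_sqrt {S : Matrix (Fin d) (Fin d) ℝ} (hS : S.PosDef) :
    IsUnit (CFC.sqrt S).det := by
  have h : CFC.sqrt S * CFC.sqrt S = S :=
    CFC.sqrt_mul_sqrt_self _ (nonneg_iff_posSemidef.2 hS.posSemidef)
  have h2 : (CFC.sqrt S).det * (CFC.sqrt S).det = S.det := by rw [← det_mul, h]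
  exact isUnit_iff_ne_zero.2 fun h0 => hS.det_pos.ne' (by rw [← h2, h0, zero_mul])

/-- The matrix of the linear Monge map solves the Riccati equation `A S₁ A = S₂`. -/
theorem mongeMatrix_mul_mul {S₁ S₂ : Matrix (Fin d) (Fin d) ℝ} (h₁ : S₁.PosDef)
    (h₂ : S₂.PosSemidef) : mongeMatrix S₁ S₂ * S₁ * mongeMatrix S₁ S₂ = S₂ := by
  have hu := isUnit_det_sqrt h₁
  have hR : (CFC.sqrt S₁).PosSemidef := nonneg_iff_posSemidef.1 (CFC.sqrt_nonneg _)
  have hS : S₁ = CFC.sqrt S₁ * CFC.sqrt S₁ :=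
    (CFC.sqrt_mul_sqrt_self _ (nonneg_iff_posSemidef.2 h₁.posSemidef)).symm
  have hM0 : (CFC.sqrt S₁ * S₂ * CFC.sqrt S₁).PosSemidef := by
    have := h₂.conjTranspose_mul_mul_same (CFC.sqrt S₁)
    rwa [hR.isHermitian.eq] at this
  have hM := CFC.sqrt_mul_sqrt_self _ (nonneg_iff_posSemidef.2 hM0)
  unfold mongeMatrix
  set R := CFC.sqrt S₁
  set M := CFC.sqrt (R * S₂ * R)
  have h1 : R⁻¹ * R = 1 := nonsing_inv_mul _ hu
  have h2 : R * R⁻¹ = 1 := mul_nonsing_inv _ hu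
  calc R⁻¹ * M * R⁻¹ * S₁ * (R⁻¹ * M * R⁻¹)
      = R⁻¹ * M * (R⁻¹ * R) * (R * R⁻¹) * M * R⁻¹ := by rw [hS]; simp only [Matrix.mul_assoc]
    _ = R⁻¹ * (M * M) * R⁻¹ := by rw [h1, h2]; simp only [Matrix.mul_assoc, Matrix.one_mul]
    _ = (R⁻¹ * R) * S₂ * (R * R⁻¹) := by rw [hM]; simp only [Matrix.mul_assoc]
    _ = S₂ := by rw [h1, h2, Matrix.one_mul, Matrix.mul_one]

theorem norm_sq_toEuclideanCLM_sqrt {S : Matrix (Fin d) (Fin d) ℝ} (hS : S.PosSemidef)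
    (x : EuclideanSpace ℝ (Fin d)) :
    ‖toEuclideanCLM (𝕜 := ℝ) (CFC.sqrt S) x‖ ^ 2 = inner ℝ x (toEuclideanCLM (𝕜 := ℝ) S x) := by
  have hR : (CFC.sqrt S).PosSemidef := nonneg_iff_posSemidef.1 (CFC.sqrt_nonneg _)
  rw [← real_inner_self_eq_norm_sq, inner_toEuclideanCLM_left hR.isHermitian,
    ← mul_apply_eq_comp, ← map_mul,
    CFC.sqrt_mul_sqrt_self _ (nonneg_iff_posSemidef.2 hS)]

/-- The Riccati equation as an identity of quadratic forms. It transfers two-sided bounds on `S₁`,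
`S₂` to bounds on the Monge matrix. -/
theorem inner_mongeMatrix {S₁ S₂ : Matrix (Fin d) (Fin d) ℝ} (h₁ : S₁.PosDef)
    (h₂ : S₂.PosSemidef) (x : EuclideanSpace ℝ (Fin d)) :
    inner ℝ (toEuclideanCLM (𝕜 := ℝ) (mongeMatrix S₁ S₂) x)
      (toEuclideanCLM (𝕜 := ℝ) S₁ (toEuclideanCLM (𝕜 := ℝ) (mongeMatrix S₁ S₂) x)) =
      inner ℝ x (toEuclideanCLM (𝕜 := ℝ) S₂ x) := by
  rw [inner_toEuclideanCLM_left mongeMatrix_posSemidef.isHermitian,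
    ← mul_apply_eq_comp, ← mul_apply_eq_comp, ← map_mul, ← map_mul,
    mongeMatrix_mul_mul h₁ h₂]

theorem norm_mongeMatrix_le {S₁ S₂ : Matrix (Fin d) (Fin d) ℝ} (h₁ : S₁.PosDef)
    (h₂ : S₂.PosSemidef) {b B : ℝ} (hb : 0 < b)
    (hS₁ : ∀ x, b * ‖x‖ ^ 2 ≤ inner ℝ x (toEuclideanCLM (𝕜 := ℝ) S₁ x))
    (hS₂ : ∀ x, inner ℝ x (toEuclideanCLM (𝕜 := ℝ) S₂ x) ≤ B * ‖x‖ ^ 2) :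
    ‖toEuclideanCLM (𝕜 := ℝ) (mongeMatrix S₁ S₂)‖ ≤ √(B / b) := by
  refine ContinuousLinearMap.opNorm_le_bound _ (Real.sqrt_nonneg _) fun x => ?_
  have h := (hS₁ _).trans ((inner_mongeMatrix h₁ h₂ x).trans_le (hS₂ x))
  set y := toEuclideanCLM (𝕜 := ℝ) (mongeMatrix S₁ S₂) x
  rw [← Real.sqrt_sq (norm_nonneg x), ← Real.sqrt_mul' _ (sq_nonneg _)]
  refine Real.le_sqrt_of_sq_le ?_
  rw [div_mul_eq_mul_div, le_div_iff₀ hb]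
  linarith

/-- At a unit eigenvector with eigenvalue `e` the Riccati identity gives `b ≤ B e²`, and `e ≥ 0`
allows the square root to be taken. -/
theorem le_inner_mongeMatrix {S₁ S₂ : Matrix (Fin d) (Fin d) ℝ} (h₁ : S₁.PosDef)
    (h₂ : S₂.PosSemidef) {b B : ℝ} (hB : 0 < B)
    (hS₁ : ∀ x, inner ℝ x (toEuclideanCLM (𝕜 := ℝ) S₁ x) ≤ B * ‖x‖ ^ 2)
    (hS₂ : ∀ x, b * ‖x‖ ^ 2 ≤ inner ℝ x (toEuclideanCLM (𝕜 := ℝ) S₂ x))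
    (x : EuclideanSpace ℝ (Fin d)) :
    √(b / B) * ‖x‖ ^ 2 ≤ inner ℝ x (toEuclideanCLM (𝕜 := ℝ) (mongeMatrix S₁ S₂) x) := by
  have hA := mongeMatrix_posSemidef (S₁ := S₁) (S₂ := S₂)
  refine le_inner_toEuclideanCLM_of_le_spectrum hA.isHermitian ?_ x
  rw [hA.isHermitian.spectrum_real_eq_range_eigenvalues]
  rintro _ ⟨i, rfl⟩
  set e := hA.isHermitian.eigenvalues i
  have he0 : 0 ≤ e := hA.eigenvalues_nonneg i
  set u := hA.isHermitian.eigenvectorBasis i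
  have hu : ‖u‖ = 1 := hA.isHermitian.eigenvectorBasis.orthonormal.1 i
  have hAu : toEuclideanCLM (𝕜 := ℝ) (mongeMatrix S₁ S₂) u = e • u := by
    have := hA.isHermitian.mulVec_eigenvectorBasis i
    ext j
    exact congrFun this j
  have h := (hS₂ u).trans ((inner_mongeMatrix h₁ h₂ u).symm.trans_le (hS₁ _))
  rw [hAu, norm_smul, hu, Real.norm_eq_abs, abs_of_nonneg he0] at h
  refine Real.sqrt_le_iff.2 ⟨he0, ?_⟩
  rw [div_le_iff₀ hB]
  linarith

/-- Perturbation bound for the matrix of the linear Monge map. The perturbed target covariance may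
be singular. -/
theorem norm_mongeMatrix_sub_le (hd : 1 ≤ d) {S₁ S₂ S₁' S₂' : Matrix (Fin d) (Fin d) ℝ}
    {b B b' δ : ℝ} (hb : 0 < b) (hB : 0 < B) (hb' : 0 < b')
    (h₁ : S₁.PosDef) (h₂ : S₂.PosSemidef) (h₁' : S₁'.PosDef) (h₂' : S₂'.PosSemidef)
    (hS₁b : ∀ x, b * ‖x‖ ^ 2 ≤ inner ℝ x (toEuclideanCLM (𝕜 := ℝ) S₁ x))
    (hS₁ : ∀ x, inner ℝ x (toEuclideanCLM (𝕜 := ℝ) S₁ x) ≤ B * ‖x‖ ^ 2)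
    (hS₂b : ∀ x, b * ‖x‖ ^ 2 ≤ inner ℝ x (toEuclideanCLM (𝕜 := ℝ) S₂ x))
    (hS₂ : ∀ x, inner ℝ x (toEuclideanCLM (𝕜 := ℝ) S₂ x) ≤ B * ‖x‖ ^ 2)
    (hS₁' : ∀ x, b' * ‖x‖ ^ 2 ≤ inner ℝ x (toEuclideanCLM (𝕜 := ℝ) S₁' x))
    (hδ₁ : ‖toEuclideanCLM (𝕜 := ℝ) (S₁' - S₁)‖ ≤ δ)
    (hδ₂ : ‖toEuclideanCLM (𝕜 := ℝ) (S₂' - S₂)‖ ≤ δ) :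
    ‖toEuclideanCLM (𝕜 := ℝ) (mongeMatrix S₁' S₂') - toEuclideanCLM (𝕜 := ℝ) (mongeMatrix S₁ S₂)‖
      ≤ (1 + B / b) * δ / (√(b / B) * b') := by
  have : Nonempty (Fin d) := ⟨⟨0, hd⟩⟩
  have hR : (CFC.sqrt S₁').PosSemidef := nonneg_iff_posSemidef.1 (CFC.sqrt_nonneg _)
  have hA := mongeMatrix_posSemidef (S₁ := S₁) (S₂ := S₂)
  have hA' := mongeMatrix_posSemidef (S₁ := S₁') (S₂ := S₂')
  refine (norm_sub_le_of_riccati _ _ (toEuclideanCLM (𝕜 := ℝ) (CFC.sqrt S₁'))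
    (inner_toEuclideanCLM_left hA.isHermitian) (inner_toEuclideanCLM_left hA'.isHermitian)
    (inner_toEuclideanCLM_left hR.isHermitian) (a := √(b / B)) (b := b') (by positivity) hb'
    (le_inner_mongeMatrix h₁ h₂ hB hS₁ hS₂b) (inner_toEuclideanCLM_nonneg hA')
    (fun x => (hS₁' x).trans_eq (norm_sq_toEuclideanCLM_sqrt h₁'.posSemidef x).symm)).trans ?_
  gcongr
  have hAn := norm_mongeMatrix_le h₁ h₂ hb hS₁b hS₂
  have hAn2 : ‖toEuclideanCLM (𝕜 := ℝ) (mongeMatrix S₁ S₂)‖ ^ 2 ≤ B / b := by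
    have := pow_le_pow_left₀ (norm_nonneg _) hAn 2
    rwa [Real.sq_sqrt (by positivity)] at this
  -- Keeping `S₁'` in the middle of both products leaves an error linear in the two perturbations
  -- and involving only the population matrix, whose norm is known.
  have hE : mongeMatrix S₁' S₂' * S₁' * mongeMatrix S₁' S₂' -
      mongeMatrix S₁ S₂ * S₁' * mongeMatrix S₁ S₂ =
      (S₂' - S₂) - mongeMatrix S₁ S₂ * (S₁' - S₁) * mongeMatrix S₁ S₂ := by
    rw [mongeMatrix_mul_mul h₁' h₂', Matrix.mul_sub, Matrix.sub_mul, mongeMatrix_mul_mul h₁ h₂]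
    abel
  rw [← map_mul, CFC.sqrt_mul_sqrt_self _ (nonneg_iff_posSemidef.2 h₁'.posSemidef), ← map_mul,
    ← map_mul, ← map_mul, ← map_mul, ← map_sub, hE, map_sub, map_mul, map_mul]
  have hδ0 : 0 ≤ δ := (norm_nonneg _).trans hδ₁
  calc _ ≤ ‖toEuclideanCLM (𝕜 := ℝ) (S₂' - S₂)‖ +
        ‖toEuclideanCLM (𝕜 := ℝ) (mongeMatrix S₁ S₂)‖ * ‖toEuclideanCLM (𝕜 := ℝ) (S₁' - S₁)‖ *
          ‖toEuclideanCLM (𝕜 := ℝ) (mongeMatrix S₁ S₂)‖ := by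
        refine (norm_sub_le _ _).trans (add_le_add le_rfl ((norm_mul_le _ _).trans ?_))
        gcongr
        exact norm_mul_le _ _
    _ ≤ δ + ‖toEuclideanCLM (𝕜 := ℝ) (mongeMatrix S₁ S₂)‖ * δ *
          ‖toEuclideanCLM (𝕜 := ℝ) (mongeMatrix S₁ S₂)‖ := by gcongr
    _ = (1 + ‖toEuclideanCLM (𝕜 := ℝ) (mongeMatrix S₁ S₂)‖ ^ 2) * δ := by ring
    _ ≤ _ := by gcongr

end Matrices

end LinearMonge

namespace LinearMonge

/-! ### Large deviations in some direction, by volume -/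

section Directions

/-- A volumetric substitute for a net argument: if the exponential moments of `F · u` are bounded
uniformly over `‖u‖ ≤ 2`, then `F` is unlikely to be large on a whole ball of radius `1/4` around
some point of the unit ball. -/
theorem measure_exists_forall_ball_le {d : ℕ} {Ω : Type*} [MeasurableSpace Ω] (P : Measure Ω)
    [SFinite P] (F : Ω → EuclideanSpace ℝ (Fin d) → ℝ) (hF : Measurable (Function.uncurry F))
    (b y : ℝ)
    (hb : ∀ u, ‖u‖ ≤ 2 → ∫⁻ ω, ENNReal.ofReal (Real.exp (F ω u)) ∂P ≤ ENNReal.ofReal (Real.exp b)) :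
    P {ω | ∃ v, ‖v‖ ≤ 1 ∧ ∀ u ∈ Metric.ball v (1 / 4), y ≤ F ω u} ≤
      ENNReal.ofReal (8 ^ d * Real.exp (b - y)) := by
  set S : Set (EuclideanSpace ℝ (Fin d)) := Metric.ball 0 2
  set V := volume (Metric.ball (0 : EuclideanSpace ℝ (Fin d)) (1 / 4)) with hV
  have hV0 : V ≠ 0 := (Metric.measure_ball_pos _ _ (by norm_num)).ne'
  have hVt : V ≠ ⊤ := measure_ball_lt_top.ne
  -- The ratio of radii is `2 / (1/4) = 8`; this volume ratio plays the role of the cardinality of a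
  -- net.
  have hSV : volume S = ENNReal.ofReal (8 ^ d) * V := by
    have := Measure.addHaar_ball_mul_of_pos
      (volume : Measure (EuclideanSpace ℝ (Fin d))) 0 (r := 8) (by norm_num) (1 / 4)
    rw [finrank_euclideanSpace_fin] at this
    rw [hV, ← this]
    norm_num [S]
  have hm : Measurable (fun p : Ω × EuclideanSpace ℝ (Fin d) => ENNReal.ofReal (Real.exp (F p.1 p.2))) :=
    (Real.measurable_exp.comp hF).ennreal_ofReal
  set G : Ω → ENNReal := fun ω => ∫⁻ u in S, ENNReal.ofReal (Real.exp (F ω u))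
  have hG : Measurable G := hm.lintegral_prod_right'
  have hGi : ∫⁻ ω, G ω ∂P ≤ ENNReal.ofReal (Real.exp b) * volume S := by
    rw [lintegral_lintegral_swap hm.aemeasurable]
    calc _ ≤ ∫⁻ _ in S, ENNReal.ofReal (Real.exp b) :=
          setLIntegral_mono measurable_const fun u hu => hb u (by
            simpa [S] using (Metric.mem_ball.1 hu).le)
      _ = _ := by simp
  have hsub : {ω | ∃ v, ‖v‖ ≤ 1 ∧ ∀ u ∈ Metric.ball v (1 / 4), y ≤ F ω u} ⊆
      {ω | ENNReal.ofReal (Real.exp y) * V ≤ G ω} := by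
    rintro ω ⟨v, hv, h⟩
    have hvS : Metric.ball v (1 / 4) ⊆ S := by
      refine Metric.ball_subset_ball' ?_
      rw [dist_zero_right]
      linarith
    calc ENNReal.ofReal (Real.exp y) * V
        = ∫⁻ _ in Metric.ball v (1 / 4), ENNReal.ofReal (Real.exp y) := by
          rw [setLIntegral_const, hV, Measure.addHaar_ball_center _ v]
      _ ≤ ∫⁻ u in Metric.ball v (1 / 4), ENNReal.ofReal (Real.exp (F ω u)) := by
          refine setLIntegral_mono' measurableSet_ball fun u hu => ?_
          exact ENNReal.ofReal_le_ofReal (Real.exp_le_exp.2 (h u hu))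
      _ ≤ G ω := lintegral_mono_set hvS
  refine (measure_mono hsub).trans ?_
  have hmk := (mul_meas_ge_le_lintegral (μ := P) hG (ENNReal.ofReal (Real.exp y) * V)).trans hGi
  have hy0 : ENNReal.ofReal (Real.exp y) ≠ 0 := by simpa using Real.exp_pos y
  rw [hSV, mul_assoc, mul_comm V, ← mul_assoc, ← mul_assoc] at hmk
  have h2 := (ENNReal.mul_le_mul_iff_left hV0 hVt).1 hmk
  rw [← ENNReal.mul_le_mul_iff_right hy0 ENNReal.ofReal_ne_top]
  refine h2.trans_eq ?_
  rw [← ENNReal.ofReal_mul (Real.exp_nonneg _), ← ENNReal.ofReal_mul (Real.exp_nonneg _)]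
  congr 1
  rw [Real.exp_sub]
  field_simp

theorem lintegral_exp_sum_pi {α : Type*} [MeasurableSpace α] (μ : Measure α)
    [IsProbabilityMeasure μ] {n : ℕ} {f : α → ℝ} (hf : Measurable f) :
    ∫⁻ x : Fin n → α, ENNReal.ofReal (Real.exp (∑ k, f (x k))) ∂(Measure.pi fun _ => μ) =
      (∫⁻ x, ENNReal.ofReal (Real.exp (f x)) ∂μ) ^ n := by
  have hg : Measurable fun x => ENNReal.ofReal (Real.exp (f x)) :=
    (Real.measurable_exp.comp hf).ennreal_ofReal
  simp_rw [Real.exp_sum, ENNReal.ofReal_prod_of_nonneg fun _ _ => Real.exp_nonneg _]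
  rw [lintegral_prod_eq_prod_lintegral_of_indepFun Finset.univ
    (fun k (x : Fin n → α) => ENNReal.ofReal (Real.exp (f (x k))))
    (iIndepFun_pi (X := fun _ x => ENNReal.ofReal (Real.exp (f x))) fun _ => hg.aemeasurable)
    (fun k => hg.comp (measurable_pi_apply k))]
  rw [Finset.prod_congr rfl fun k _ =>
    (measurePreserving_eval (fun _ : Fin n => μ) k).lintegral_comp hg]
  simp

end Directions

/-! ### Squares of sub-Gaussian variables -/

section Scalar

/-- Taylor remainder of order two. For a centered variable the linear term integrates to zero,
leaving a contribution quadratic in the parameter. -/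
theorem exp_le_one_add_add_sq_mul_exp_abs (x : ℝ) :
    Real.exp x ≤ 1 + x + x ^ 2 * Real.exp |x| := by
  have h := Complex.norm_exp_sub_sum_le_norm_mul_exp (x : ℂ) 2
  have h2 : Complex.exp x - ∑ m ∈ Finset.range 2, (x : ℂ) ^ m / m.factorial =
      ((Real.exp x - (1 + x) : ℝ) : ℂ) := by
    simp [Finset.sum_range_succ]
  rw [h2, Complex.norm_real, Complex.norm_real, Real.norm_eq_abs, Real.norm_eq_abs, sq_abs] at h
  linarith [le_abs_self (Real.exp x - (1 + x))]

/-- Multiplying by the density leaves `exp (-g²/4) / √(2π)`, whose integral is `√2`. -/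
theorem lintegral_exp_sq_gaussianReal_le :
    ∫⁻ g, ENNReal.ofReal (Real.exp (g ^ 2 / 4)) ∂(gaussianReal 0 1) ≤ 2 := by
  rw [gaussianReal_of_var_ne_zero _ one_ne_zero,
    lintegral_withDensity_eq_lintegral_mul _ (measurable_gaussianPDF 0 1) (by fun_prop)]
  have h1 : ∀ g : ℝ, (gaussianPDF 0 1 * fun g => ENNReal.ofReal (Real.exp (g ^ 2 / 4))) g =
      ENNReal.ofReal ((√(2 * Real.pi))⁻¹ * Real.exp (-(1 / 4) * g ^ 2)) := fun g => by
    rw [Pi.mul_apply, gaussianPDF, ← ENNReal.ofReal_mul (gaussianPDFReal_nonneg _ _ _),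
      gaussianPDFReal, mul_assoc, ← Real.exp_add]
    congr 2
    · simp
    · congr 1
      simp
      ring
  simp_rw [h1]
  rw [← ofReal_integral_eq_lintegral_ofReal
    ((integrable_exp_neg_mul_sq (by norm_num)).const_mul _)
    (ae_of_all _ fun _ => by positivity), integral_const_mul, integral_gaussian,
    ← Real.sqrt_inv, ← Real.sqrt_mul (by positivity)]
  rw [show (2 : ENNReal) = ENNReal.ofReal 2 by simp]
  refine ENNReal.ofReal_le_ofReal (Real.sqrt_le_iff.2 ⟨by norm_num, ?_⟩)
  have := Real.pi_pos
  field_simp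
  norm_num

variable {Ω : Type*} [MeasurableSpace Ω] {P : Measure Ω}

theorem lintegral_exp_mul_le_of_hasSubgaussianMGF {Z : Ω → ℝ} {V : NNReal}
    (h : HasSubgaussianMGF Z V P) (t : ℝ) :
    ∫⁻ ω, ENNReal.ofReal (Real.exp (t * Z ω)) ∂P ≤ ENNReal.ofReal (Real.exp (V * t ^ 2 / 2)) := by
  rw [← ofReal_integral_eq_lintegral_ofReal (h.integrable_exp_mul t)
    (ae_of_all _ fun _ => Real.exp_nonneg _)]
  exact ENNReal.ofReal_le_ofReal (h.mgf_le t)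

/-- Linearization of the square: `exp (z² / (4V))` is the mean of `exp (s z g)` over a standard
Gaussian `g` when `s² = 1 / (2V)`. Swapping integrals, the sub-Gaussian bound at parameter `s g`
leaves `exp (g² / 4)`. -/
theorem lintegral_exp_sq_le_of_hasSubgaussianMGF [SFinite P] {Z : Ω → ℝ} (hZ : Measurable Z)
    {V : NNReal} (hV : 0 < V) (h : HasSubgaussianMGF Z V P) :
    ∫⁻ ω, ENNReal.ofReal (Real.exp (Z ω ^ 2 / (4 * V))) ∂P ≤ 2 := by
  have hV' : (0 : ℝ) < V := hV
  set s : ℝ := √(1 / (2 * V))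
  have hs : s ^ 2 = 1 / (2 * V) := Real.sq_sqrt (by positivity)
  have h1 : ∀ z : ℝ, ENNReal.ofReal (Real.exp (z ^ 2 / (4 * V))) =
      ∫⁻ g, ENNReal.ofReal (Real.exp (s * z * g)) ∂(gaussianReal 0 1) := fun z => by
    rw [← ofReal_integral_eq_lintegral_ofReal (integrable_exp_mul_gaussianReal _)
      (ae_of_all _ fun _ => Real.exp_nonneg _)]
    have := congrFun (mgf_fun_id_gaussianReal (μ := 0) (v := 1)) (s * z)
    rw [mgf] at this
    rw [this, mul_pow, hs]
    congr 2
    simp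
    field_simp
    norm_num
  simp_rw [h1]
  rw [lintegral_lintegral_swap (by fun_prop)]
  refine (lintegral_mono fun g => ?_).trans lintegral_exp_sq_gaussianReal_le
  have := lintegral_exp_mul_le_of_hasSubgaussianMGF h (s * g)
  simp_rw [mul_right_comm s _ g]
  refine this.trans_eq ?_
  rw [mul_pow, hs]
  congr 2
  field_simp
  ring

/-- The centered square of a sub-Gaussian variable is sub-exponential. -/
theorem lintegral_exp_mul_sq_sub_le [IsProbabilityMeasure P] {Z : Ω → ℝ} (hZ : Measurable Z)
    {V : NNReal} (hV : 0 < V) (h : HasSubgaussianMGF Z V P) {t : ℝ} (ht : |t| ≤ 1 / (8 * V)) :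
    ∫⁻ ω, ENNReal.ofReal (Real.exp (t * (Z ω ^ 2 - ∫ ω, Z ω ^ 2 ∂P))) ∂P ≤
      ENNReal.ofReal (Real.exp (2048 * V ^ 2 * t ^ 2)) := by
  have hV' : (0 : ℝ) < V := hV
  set w := ∫ ω, Z ω ^ 2 ∂P with hw
  set a : ℝ := 1 / (4 * V) with ha
  have ha0 : 0 < a := by positivity
  have hq : ∀ z : ℝ, z ^ 2 / (4 * V) = a * z ^ 2 := fun z => by rw [ha]; ring
  have hS := lintegral_exp_sq_le_of_hasSubgaussianMGF hZ hV h
  simp_rw [hq] at hS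
  have hme : AEStronglyMeasurable (fun ω => Real.exp (a * Z ω ^ 2)) P :=
    Measurable.aestronglyMeasurable (by fun_prop)
  have hI : Integrable (fun ω => Real.exp (a * Z ω ^ 2)) P := by
    refine ⟨hme, ?_⟩
    rw [hasFiniteIntegral_iff_ofReal (ae_of_all _ fun _ => Real.exp_nonneg _)]
    exact hS.trans_lt (by simp)
  have hI2 : ∫ ω, Real.exp (a * Z ω ^ 2) ∂P ≤ 2 := by
    rw [← ENNReal.ofReal_le_ofReal_iff (by norm_num), ofReal_integral_eq_lintegral_ofReal hI
      (ae_of_all _ fun _ => Real.exp_nonneg _)]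
    simpa using hS
  have hZ2 : Integrable (fun ω => Z ω ^ 2) P := by
    simpa using (h.memLp 2).integrable_sq
  have hw0 : 0 ≤ w := integral_nonneg fun _ => sq_nonneg _
  have haw : a * w ≤ 1 := by
    have : ∫ ω, (a * Z ω ^ 2 + 1) ∂P ≤ ∫ ω, Real.exp (a * Z ω ^ 2) ∂P :=
      integral_mono ((hZ2.const_mul a).add (integrable_const _)) hI
        fun ω => Real.add_one_le_exp _
    rw [integral_add (hZ2.const_mul a) (integrable_const _), integral_const_mul] at this
    simp only [integral_const, probReal_univ, smul_eq_mul, one_mul] at this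
    linarith
  have ht' : |t| ≤ a / 2 := ht.trans_eq (by rw [ha]; field_simp; norm_num)
  -- The proof below needs `8 / a² = 128 V²` times `exp 1`, and `exp 1 ≤ 8`.
  set c : ℝ := 16 * V ^ 2 * 64 with hc
  have hpt : ∀ ω, Real.exp (t * (Z ω ^ 2 - w)) ≤
      1 + t * (Z ω ^ 2 - w) + t ^ 2 * (c * Real.exp (a * Z ω ^ 2)) := fun ω => by
    refine (exp_le_one_add_add_sq_mul_exp_abs _).trans ?_
    set W := Z ω ^ 2 - w
    -- Half of the exponent `a |W|` absorbs `W²`, the other half `exp |t W|`; then `a |W| ≤ 1 + a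
    -- Z²` because `a w ≤ 1`.
    have h1 : W ^ 2 * Real.exp |t * W| ≤ c * Real.exp (a * Z ω ^ 2) := by
      have h2 : |t * W| ≤ a / 2 * |W| := by
        rw [abs_mul]; gcongr
      have h3 : W ^ 2 ≤ 8 / a ^ 2 * Real.exp (a / 2 * |W|) := by
        have := Real.quadratic_le_exp_of_nonneg (x := a / 2 * |W|) (by positivity)
        have h4 : (a / 2 * |W|) ^ 2 / 2 ≤ Real.exp (a / 2 * |W|) := by
          have : 0 ≤ a / 2 * |W| := by positivity
          linarith
        rw [mul_pow, sq_abs] at h4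
        rw [div_mul_eq_mul_div, le_div_iff₀ (by positivity)]
        linarith
      have h5 : a * |W| ≤ 1 + a * Z ω ^ 2 := by
        have : |W| ≤ w + Z ω ^ 2 := abs_le.2 ⟨by linarith [sq_nonneg (Z ω)], by linarith⟩
        nlinarith
      calc W ^ 2 * Real.exp |t * W|
          ≤ (8 / a ^ 2 * Real.exp (a / 2 * |W|)) * Real.exp (a / 2 * |W|) := by gcongr
        _ = 8 / a ^ 2 * Real.exp (a * |W|) := by
            rw [mul_assoc, ← Real.exp_add]; congr 2; ring
        _ ≤ 8 / a ^ 2 * Real.exp (1 + a * Z ω ^ 2) := by gcongr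
        _ = 8 / a ^ 2 * Real.exp 1 * Real.exp (a * Z ω ^ 2) := by rw [Real.exp_add]; ring
        _ ≤ c * Real.exp (a * Z ω ^ 2) := by
            gcongr
            rw [hc, ha]
            have := Real.exp_one_lt_d9
            field_simp
            nlinarith
    rw [mul_pow, mul_assoc (t ^ 2)]
    gcongr
  have hi1 : Integrable (fun ω => 1 + t * (Z ω ^ 2 - w)) P :=
    (integrable_const _).add ((hZ2.sub (integrable_const _)).const_mul _)
  have hi2 : Integrable (fun ω => t ^ 2 * (c * Real.exp (a * Z ω ^ 2))) P :=
    (hI.const_mul _).const_mul _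
  refine (lintegral_mono fun ω => ENNReal.ofReal_le_ofReal (hpt ω)).trans ?_
  have hi12 : Integrable
      (fun ω => 1 + t * (Z ω ^ 2 - w) + t ^ 2 * (c * Real.exp (a * Z ω ^ 2))) P := hi1.add hi2
  rw [← ofReal_integral_eq_lintegral_ofReal hi12
    (ae_of_all _ fun ω => (Real.exp_nonneg _).trans (hpt ω))]
  refine ENNReal.ofReal_le_ofReal ?_
  have e1 : ∫ ω, (1 + t * (Z ω ^ 2 - w) + t ^ 2 * (c * Real.exp (a * Z ω ^ 2))) ∂P =
      1 + t ^ 2 * (c * ∫ ω, Real.exp (a * Z ω ^ 2) ∂P) := by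
    have hi3 : Integrable (fun ω => t * (Z ω ^ 2 - w)) P :=
      (hZ2.sub (integrable_const _)).const_mul _
    rw [integral_add hi1 hi2, integral_add (integrable_const _) hi3, integral_const_mul,
      integral_const_mul, integral_const_mul, integral_sub hZ2 (integrable_const _)]
    simp [← hw]
  rw [e1]
  refine le_trans ?_ (Real.add_one_le_exp _)
  have hc0 : 0 ≤ t ^ 2 * c := by positivity
  have := mul_le_mul_of_nonneg_left hI2 hc0
  rw [hc] at this ⊢
  nlinarith

end Scalar

end LinearMonge

namespace LinearMonge

open Matrix

variable {d : ℕ} {μ : Measure (EuclideanSpace ℝ (Fin d))} {K : ℝ}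

/-! ### Mean, covariance and marginals of a sub-Gaussian measure -/

section Moments

theorem memLp_eval (hμ : MemLp id 2 μ) (i : Fin d) :
    MemLp (fun x : EuclideanSpace ℝ (Fin d) => x i) 2 μ := MemLp.eval_piLp hμ i

theorem covMatrix_isHermitian : (covMatrix μ).IsHermitian := by
  ext i j
  simp [covMatrix, covariance_comm]

variable [IsProbabilityMeasure μ]

theorem IsSubGaussian.memLp_id (h : IsSubGaussian K μ) : MemLp id 2 μ := by
  refine MemLp.of_eval_piLp fun i => ?_
  have h1 := (h (EuclideanSpace.single i 1)).memLp 2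
  have h2 : MemLp (fun x : EuclideanSpace ℝ (Fin d) => x i - mean μ i) 2 μ := by
    simpa [EuclideanSpace.inner_single_left] using h1
  convert! h2.add (memLp_const (mean μ i)) using 1
  ext x
  simp

theorem mean_apply (hμ : MemLp id 2 μ) (i : Fin d) : mean μ i = ∫ x, x i ∂μ :=
  ((EuclideanSpace.proj (𝕜 := ℝ) i).integral_comp_comm (hμ.integrable (by norm_num))).symm

theorem variance_inner (hμ : MemLp id 2 μ) (u : EuclideanSpace ℝ (Fin d)) :
    Var[fun x => inner ℝ u x; μ] = inner ℝ u (toEuclideanCLM (𝕜 := ℝ) (covMatrix μ) u) := by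
  rw [← covarianceBilin_self hμ]
  have h := covarianceBilin_apply_pi (μ := μ) (memLp_eval hμ) u u
  have hid : μ.map (fun x : EuclideanSpace ℝ (Fin d) => WithLp.toLp 2 fun i => x i) = μ :=
    Measure.map_id
  rw [hid] at h
  rw [h, inner_toEuclideanCLM]
  simp only [dotProduct, mulVec, covMatrix, of_apply, Finset.mul_sum]
  exact Finset.sum_congr rfl fun i _ => Finset.sum_congr rfl fun j _ => by ring

theorem integral_inner_sub_mean_sq (hμ : MemLp id 2 μ) (u : EuclideanSpace ℝ (Fin d)) :
    ∫ x, inner ℝ u (x - mean μ) ^ 2 ∂μ =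
      inner ℝ u (toEuclideanCLM (𝕜 := ℝ) (covMatrix μ) u) := by
  have h := covarianceBilin_apply hμ u u
  rw [covarianceBilin_self hμ, variance_inner hμ] at h
  rw [h]
  exact integral_congr_ae (ae_of_all _ fun x => by simp only [mean, id, sq])

theorem covMatrix_apply_self (hμ : MemLp id 2 μ) (i : Fin d) :
    covMatrix μ i i = ∫ x, (x i - mean μ i) ^ 2 ∂μ := by
  simp only [covMatrix, of_apply, covariance, mean_apply hμ, sq]

theorem integral_norm_sub_mean_sq (hμ : MemLp id 2 μ) :
    ∫ x, ‖x - mean μ‖ ^ 2 ∂μ = (covMatrix μ).trace := by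
  simp only [trace, diag, covMatrix_apply_self hμ, EuclideanSpace.norm_sq_eq]
  rw [integral_finsetSum _ fun i _ => ?_]
  · simp
  · have := ((memLp_eval hμ i).sub (memLp_const (mean μ i))).integrable_sq
    simpa using this

/-- Nonnegativity of the variance of `‖x - mean μ‖`. -/
theorem integral_norm_sub_mean_le (hμ : MemLp id 2 μ) :
    ∫ x, ‖x - mean μ‖ ∂μ ≤ √(covMatrix μ).trace := by
  have h1 : MemLp (fun x => ‖x - mean μ‖) 2 μ := (hμ.sub (memLp_const (mean μ))).norm
  refine Real.le_sqrt_of_sq_le ?_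
  rw [← integral_norm_sub_mean_sq hμ]
  have h2 := variance_nonneg (fun x => ‖x - mean μ‖) μ
  rw [variance_eq_sub h1] at h2
  simpa using h2

/-- Uniform sub-Gaussian parameter of the one-dimensional marginals. -/
theorem IsSubGaussian.hasSubgaussianMGF (h : IsSubGaussian K μ) {C : ℝ} (hC0 : 0 ≤ C)
    (hC : lambdaMax (covMatrix μ) ≤ C) {u : EuclideanSpace ℝ (Fin d)} (hu : ‖u‖ ≤ 2) :
    HasSubgaussianMGF (fun x => inner ℝ u (x - mean μ)) (Real.toNNReal (4 * K ^ 2 * C)) μ := by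
  refine ⟨(h u).integrable_exp_mul, fun t => ((h u).mgf_le t).trans ?_⟩
  -- The factor 4 is the squared radius of the ball over which directions are integrated.
  have h1 : K ^ 2 * Var[fun x => inner ℝ u x; μ] ≤ 4 * K ^ 2 * C := by
    rw [variance_inner h.memLp_id]
    have h2 := le_lambdaMax_mul (covMatrix_isHermitian (μ := μ)) u
    have h0 : 0 ≤ inner ℝ u (toEuclideanCLM (𝕜 := ℝ) (covMatrix μ) u) := by
      rw [← variance_inner h.memLp_id]; exact variance_nonneg _ _
    have h3 : inner ℝ u (toEuclideanCLM (𝕜 := ℝ) (covMatrix μ) u) ≤ C * ‖u‖ ^ 2 :=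
      h2.trans (by gcongr)
    have h4 : ‖u‖ ^ 2 ≤ 4 := by nlinarith [norm_nonneg u]
    have h5 : inner ℝ u (toEuclideanCLM (𝕜 := ℝ) (covMatrix μ) u) ≤ 4 * C := by nlinarith
    nlinarith [sq_nonneg K]
  gcongr

end Moments

/-! ### Empirical moments and recentring -/

section Samples

variable {n : ℕ}

/-- Empirical second moments of a sample around a given center. -/
noncomputable def momentMatrix (m : EuclideanSpace ℝ (Fin d))
    (x : Fin n → EuclideanSpace ℝ (Fin d)) : Matrix (Fin d) (Fin d) ℝ :=
  Matrix.of fun i j => (n : ℝ)⁻¹ * ∑ k, (x k i - m i) * (x k j - m j)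

theorem empCov_eq_momentMatrix (x : Fin n → EuclideanSpace ℝ (Fin d)) :
    empCov x = momentMatrix (empMean x) x := rfl

theorem momentMatrix_isHermitian (m : EuclideanSpace ℝ (Fin d))
    (x : Fin n → EuclideanSpace ℝ (Fin d)) : (momentMatrix m x).IsHermitian := by
  ext i j
  simp [momentMatrix, mul_comm]

theorem inner_momentMatrix (m : EuclideanSpace ℝ (Fin d))
    (x : Fin n → EuclideanSpace ℝ (Fin d)) (u : EuclideanSpace ℝ (Fin d)) :
    inner ℝ u (toEuclideanCLM (𝕜 := ℝ) (momentMatrix m x) u) =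
      (n : ℝ)⁻¹ * ∑ k, inner ℝ u (x k - m) ^ 2 := by
  have h : ∀ k, inner ℝ u (x k - m) = ∑ i, u i * (x k i - m i) := fun k => by
    simp [PiLp.inner_apply, mul_comm]
  simp only [inner_toEuclideanCLM, dotProduct, mulVec, momentMatrix, of_apply, h, sq,
    Finset.sum_mul_sum]
  rw [Finset.sum_comm, Finset.mul_sum]
  refine Finset.sum_congr rfl fun i _ => ?_
  rw [Finset.sum_comm, Finset.mul_sum, Finset.mul_sum]
  refine Finset.sum_congr rfl fun j _ => ?_
  simp only [Finset.mul_sum, Finset.sum_mul]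
  exact Finset.sum_congr rfl fun k _ => by ring

theorem momentMatrix_posSemidef (m : EuclideanSpace ℝ (Fin d))
    (x : Fin n → EuclideanSpace ℝ (Fin d)) : (momentMatrix m x).PosSemidef := by
  refine PosSemidef.of_dotProduct_mulVec_nonneg (momentMatrix_isHermitian m x) fun v => ?_
  have h := inner_momentMatrix m x (WithLp.toLp 2 v)
  rw [inner_toEuclideanCLM] at h
  refine le_of_le_of_eq ?_ h.symm
  positivity

theorem inner_empMean_sub (hn : n ≠ 0) (m : EuclideanSpace ℝ (Fin d))
    (x : Fin n → EuclideanSpace ℝ (Fin d)) (u : EuclideanSpace ℝ (Fin d)) :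
    ∑ k, inner ℝ u (x k - m) = n * inner ℝ u (empMean x - m) := by
  have hn' : (n : ℝ) ≠ 0 := by exact_mod_cast hn
  simp only [empMean, inner_sub_right, inner_smul_right, inner_sum, Finset.sum_sub_distrib]
  simp
  field_simp

/-- Around a fixed center the summands are functions of single observations, so exponential moments
factor; the price of recentring is the squared deviation of the mean, a higher-order term. -/
theorem inner_empCov (hn : n ≠ 0) (m : EuclideanSpace ℝ (Fin d))
    (x : Fin n → EuclideanSpace ℝ (Fin d)) (u : EuclideanSpace ℝ (Fin d)) :
    inner ℝ u (toEuclideanCLM (𝕜 := ℝ) (empCov x) u) =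
      inner ℝ u (toEuclideanCLM (𝕜 := ℝ) (momentMatrix m x) u) -
        inner ℝ u (empMean x - m) ^ 2 := by
  have hn' : (n : ℝ) ≠ 0 := by exact_mod_cast hn
  rw [empCov_eq_momentMatrix, inner_momentMatrix, inner_momentMatrix]
  have h1 := inner_empMean_sub hn m x u
  set w := inner ℝ u (empMean x - m) with hw
  have h2 : ∀ k, inner ℝ u (x k - empMean x) = inner ℝ u (x k - m) - w := fun k => by
    rw [hw, ← inner_sub_right]; congr 1; abel
  simp only [h2, sub_sq, Finset.sum_add_distrib, Finset.sum_sub_distrib, ← Finset.sum_mul,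
    ← Finset.mul_sum, h1]
  simp
  field_simp
  ring

theorem norm_empCov_sub_le (hd : 1 ≤ d) (hn : n ≠ 0) {S : Matrix (Fin d) (Fin d) ℝ}
    (hS : S.IsHermitian) (m : EuclideanSpace ℝ (Fin d)) (x : Fin n → EuclideanSpace ℝ (Fin d)) :
    ‖toEuclideanCLM (𝕜 := ℝ) (empCov x - S)‖ ≤
      ‖toEuclideanCLM (𝕜 := ℝ) (momentMatrix m x - S)‖ + ‖empMean x - m‖ ^ 2 := by
  refine norm_toEuclideanCLM_le_of_abs_inner_le hd
    ((momentMatrix_isHermitian (empMean x) x).sub hS) fun u => ?_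
  have h1 : inner ℝ u (toEuclideanCLM (𝕜 := ℝ) (empCov x - S) u) =
      inner ℝ u (toEuclideanCLM (𝕜 := ℝ) (momentMatrix m x - S) u) -
        inner ℝ u (empMean x - m) ^ 2 := by
    rw [map_sub, map_sub, _root_.sub_apply, _root_.sub_apply, inner_sub_right, inner_sub_right,
      inner_empCov hn m x]
    ring
  rw [← empCov_eq_momentMatrix, h1]
  have h2 : |inner ℝ u (toEuclideanCLM (𝕜 := ℝ) (momentMatrix m x - S) u)| ≤
      ‖toEuclideanCLM (𝕜 := ℝ) (momentMatrix m x - S)‖ * ‖u‖ ^ 2 := by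
    refine (abs_real_inner_le_norm _ _).trans ?_
    have := (toEuclideanCLM (𝕜 := ℝ) (momentMatrix m x - S)).le_opNorm u
    nlinarith [norm_nonneg u]
  have h3 : inner ℝ u (empMean x - m) ^ 2 ≤ ‖empMean x - m‖ ^ 2 * ‖u‖ ^ 2 := by
    rw [← mul_pow, mul_comm, ← sq_abs]
    gcongr
    exact abs_real_inner_le_norm _ _
  refine (abs_sub _ _).trans ?_
  rw [abs_of_nonneg (sq_nonneg (inner ℝ u (empMean x - m))), add_mul]
  exact add_le_add h2 h3

end Samples

end LinearMonge

/-! ### Concentration of the sample mean and covariance -/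

namespace LinearMonge

open Matrix

theorem eight_pow_mul_exp_le (d : ℕ) {a s : ℝ} (h : 3 * d + a ≤ -s) :
    8 ^ d * Real.exp a ≤ Real.exp (-s) := by
  have h2 : (2 : ℝ) ≤ Real.exp 1 := by linarith [Real.add_one_le_exp (1 : ℝ)]
  have h8 : (8 : ℝ) ≤ Real.exp 3 := by
    rw [show (3 : ℝ) = ((3 : ℕ) : ℝ) * 1 by norm_num, Real.exp_nat_mul]
    calc (8 : ℝ) = 2 ^ 3 := by norm_num
      _ ≤ _ := by gcongr
  calc (8 : ℝ) ^ d * Real.exp a ≤ Real.exp 3 ^ d * Real.exp a := by gcongr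
    _ = Real.exp (3 * d + a) := by rw [← Real.exp_nat_mul, ← Real.exp_add, mul_comm 3]
    _ ≤ _ := Real.exp_le_exp.2 h

variable {E : Type*} [NormedAddCommGroup E] [InnerProductSpace ℝ E]

/-- Around `v = w / ‖w‖` a displacement shorter than `1/4` costs at most `‖w‖ / 4`. -/
theorem exists_forall_ball_le_inner (w : E) (hw : w ≠ 0) :
    ∃ v : E, ‖v‖ ≤ 1 ∧ ∀ u ∈ Metric.ball v (1 / 4), 3 / 4 * ‖w‖ ≤ inner ℝ u w := by
  have hw' : 0 < ‖w‖ := norm_pos_iff.2 hw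
  refine ⟨‖w‖⁻¹ • w, ?_, fun u hu => ?_⟩
  · rw [norm_smul, norm_inv, norm_norm, inv_mul_cancel₀ hw'.ne']
  · rw [Metric.mem_ball, dist_eq_norm] at hu
    have h1 : inner ℝ u w = ‖w‖ + inner ℝ (u - ‖w‖⁻¹ • w) w := by
      rw [inner_sub_left, real_inner_smul_left, real_inner_self_eq_norm_sq]
      field_simp
      ring
    have h2 := (abs_le.1 (abs_real_inner_le_norm (u - ‖w‖⁻¹ • w) w)).1
    nlinarith

/-- The quadratic form of a symmetric operator, up to its sign, stays comparable to the operator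
norm on a ball around a suitable unit vector. -/
theorem exists_forall_ball_le_quadratic [FiniteDimensional ℝ E] [Nontrivial E] (T : E →L[ℝ] E)
    (hT : ∀ x y, inner ℝ (T x) y = inner ℝ x (T y)) :
    ∃ v : E, ‖v‖ ≤ 1 ∧ ((∀ u ∈ Metric.ball v (1 / 4), 7 / 16 * ‖T‖ ≤ inner ℝ u (T u)) ∨
      ∀ u ∈ Metric.ball v (1 / 4), 7 / 16 * ‖T‖ ≤ -inner ℝ u (T u)) := by
  obtain ⟨v, hv, l, hl, hlT⟩ := exists_unit_eigenvector_abs_eq_norm T hT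
  -- Perturbing by `h` with `‖h‖ < 1/4` changes the form by at most `2 · 1/4 + 1/16 = 9/16` of the
  -- norm, which leaves `7/16`.
  have key : ∀ u ∈ Metric.ball v (1 / 4), |inner ℝ u (T u) - l| ≤ 9 / 16 * ‖T‖ := fun u hu => by
    rw [Metric.mem_ball, dist_eq_norm] at hu
    set h := u - v with hh
    have hu' : u = v + h := by rw [hh]; abel
    have h1 : inner ℝ u (T u) - l = 2 * (l * inner ℝ h v) + inner ℝ h (T h) := by
      rw [hu', map_add, inner_add_left, inner_add_right, inner_add_right, ← hT v h, hl,
        inner_smul_left, inner_smul_right, inner_smul_right, real_inner_self_eq_norm_sq, hv,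
        real_inner_comm h v]
      simp only [conj_trivial]
      ring
    rw [h1]
    have h2 : |inner ℝ h v| ≤ 1 / 4 :=
      (abs_real_inner_le_norm h v).trans (by rw [hv, mul_one]; exact hu.le)
    have h3 : |inner ℝ h (T h)| ≤ ‖T‖ * (1 / 4) ^ 2 := by
      calc _ ≤ ‖h‖ * ‖T h‖ := abs_real_inner_le_norm _ _
        _ ≤ ‖h‖ * (‖T‖ * ‖h‖) := by gcongr; exact T.le_opNorm _
        _ = ‖T‖ * ‖h‖ ^ 2 := by ring
        _ ≤ _ := by gcongr
    refine (abs_add_le _ _).trans ?_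
    rw [abs_mul, abs_mul, hlT, abs_two]
    nlinarith [norm_nonneg T]
  refine ⟨v, hv.le, ?_⟩
  rcases abs_choice l with h | h
  · refine Or.inl fun u hu => ?_
    have := (abs_le.1 (key u hu)).1
    linarith
  · refine Or.inr fun u hu => ?_
    have := (abs_le.1 (key u hu)).2
    linarith

variable {d : ℕ} {μ : Measure (EuclideanSpace ℝ (Fin d))} [IsProbabilityMeasure μ] {K C : ℝ}
  {n : ℕ} {s : ℝ}

theorem measure_empMean_deviation_le (h : IsSubGaussian K μ) (hC0 : 0 ≤ C)
    (hC : lambdaMax (covMatrix μ) ≤ C) (hn : n ≠ 0) (hs : 0 < s) :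
    (Measure.pi fun _ : Fin n => μ)
      {x | ¬ ‖empMean x - mean μ‖ ≤ (4 * K ^ 2 * C + 8) * √((d + s) / n)} ≤
      ENNReal.ofReal (Real.exp (-s)) := by
  have hn' : (0 : ℝ) < n := by exact_mod_cast Nat.pos_of_ne_zero hn
  set V := 4 * K ^ 2 * C with hVdef
  have hV : 0 ≤ V := by positivity
  set η := (d + s) / n with hη
  have hη0 : 0 < η := by positivity
  have hnη : n * η = d + s := by rw [hη]; field_simp
  have hsq : √η * √η = η := Real.mul_self_sqrt hη0.le
  -- Chernoff parameter `√η`: the log-moment `n V η / 2` minus the threshold is `-(V/4 + 6)(d + s)`,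
  -- enough to pay `3 d` for `8 ^ d` and keep `-s`.
  refine le_trans ?_ ((measure_exists_forall_ball_le (d := d) (Measure.pi fun _ : Fin n => μ)
    (fun x u => ∑ k, √η * inner ℝ u (x k - mean μ)) ?_ (n * (V * η / 2))
      (3 / 4 * (V + 8) * (n * η)) ?_).trans (ENNReal.ofReal_le_ofReal (eight_pow_mul_exp_le d ?_)))
  · refine measure_mono fun x hx => ?_
    rw [Set.mem_ofPred_eq, not_le] at hx
    have hw : empMean x - mean μ ≠ 0 := fun h0 => by
      rw [h0, norm_zero] at hx
      exact absurd hx (not_lt.2 (by positivity))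
    obtain ⟨v, hv, hvu⟩ := exists_forall_ball_le_inner _ hw
    refine ⟨v, hv, fun u hu => ?_⟩
    rw [← Finset.mul_sum, inner_empMean_sub hn]
    calc 3 / 4 * (V + 8) * (n * η) = √η * (n * (3 / 4 * ((V + 8) * √η))) := by
          linear_combination (-(3 / 4 * (V + 8) * n)) * hsq
      _ ≤ √η * (n * (3 / 4 * ‖empMean x - mean μ‖)) := by gcongr
      _ ≤ _ := by gcongr; exact hvu u hu
  · simp only [Function.uncurry_def]
    fun_prop
  · intro u hu
    rw [lintegral_exp_sum_pi μ (f := fun x => √η * inner ℝ u (x - mean μ)) (by fun_prop),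
      Real.exp_nat_mul, ENNReal.ofReal_pow (Real.exp_nonneg _)]
    gcongr
    refine (lintegral_exp_mul_le_of_hasSubgaussianMGF
      (h.hasSubgaussianMGF hC0 hC hu) √η).trans_eq ?_
    rw [Real.coe_toNNReal _ hV, Real.sq_sqrt hη0.le]
  · have : n * (V * η / 2) - 3 / 4 * (V + 8) * (n * η) = -(V / 4 + 6) * (n * η) := by ring
    rw [this, hnη]
    have : (0 : ℝ) ≤ d := Nat.cast_nonneg d
    nlinarith

theorem measure_momentMatrix_deviation_le (h : IsSubGaussian K μ) (hK : 0 < K) (hC0 : 0 < C)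
    (hC : lambdaMax (covMatrix μ) ≤ C) (hd : 1 ≤ d) (hn : n ≠ 0) (hs : 0 < s) :
    (Measure.pi fun _ : Fin n => μ)
      {x | ¬ ‖toEuclideanCLM (𝕜 := ℝ) (momentMatrix (mean μ) x - covMatrix μ)‖ ≤
        800 * (4 * K ^ 2 * C) * max √((d + s) / n) ((d + s) / n)} ≤
      ENNReal.ofReal (Real.exp (-s)) + ENNReal.ofReal (Real.exp (-s)) := by
  have : Nonempty (Fin d) := ⟨⟨0, hd⟩⟩
  have hn' : (0 : ℝ) < n := by exact_mod_cast Nat.pos_of_ne_zero hn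
  set V := 4 * K ^ 2 * C with hVdef
  have hV : 0 < V := by positivity
  set η := (d + s) / n with hη
  have hη0 : 0 < η := by positivity
  have hnη : n * η = d + s := by rw [hη]; field_simp
  have hsq : √η * √η = η := Real.mul_self_sqrt hη0.le
  have hs0 : 0 < √η := Real.sqrt_pos.2 hη0
  -- The cap `1 / (8V)` is the range of the sub-exponential estimate; the minimum makes `t * max √η
  -- η = η / (8V)` in both regimes.
  set t := 1 / (8 * V) * min 1 √η with ht
  have ht0 : 0 < t := by positivity
  have htη : t * max √η η = 1 / (8 * V) * η := by
    rw [ht, mul_assoc]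
    congr 1
    rcases le_total √η 1 with h1 | h1
    · have : η ≤ √η := by nlinarith
      rw [min_eq_right h1, max_eq_left this, hsq]
    · have : √η ≤ η := by nlinarith
      rw [min_eq_left h1, max_eq_right this, one_mul]
  have ht1 : t ≤ 1 / (8 * V) := mul_le_of_le_one_right (by positivity) (min_le_left _ _)
  have ht2 : t ^ 2 ≤ (1 / (8 * V)) ^ 2 * η := by
    rw [ht, mul_pow]
    gcongr
    calc (min 1 √η) ^ 2 ≤ √η ^ 2 := by gcongr; exact min_le_right _ _
      _ = η := Real.sq_sqrt hη0.le
  set q : EuclideanSpace ℝ (Fin d) → ℝ := fun u =>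
    inner ℝ u (toEuclideanCLM (𝕜 := ℝ) (covMatrix μ) u) with hq
  have hqm : Measurable q := by fun_prop
  have hsum : ∀ (e : ℝ) (x : Fin n → EuclideanSpace ℝ (Fin d)) u,
      ∑ k, e * t * (inner ℝ u (x k - mean μ) ^ 2 - q u) = n * t *
        (e * inner ℝ u (toEuclideanCLM (𝕜 := ℝ) (momentMatrix (mean μ) x - covMatrix μ) u)) := by
    intro e x u
    rw [← Finset.mul_sum, Finset.sum_sub_distrib, map_sub, _root_.sub_apply, inner_sub_right,
      inner_momentMatrix, hq]
    simp
    field_simp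
  -- The sign `e` covers both signs of the extreme eigenvalue, hence two terms in the bound. A
  -- deviation of `800 V max √η η` yields exponent `7/16 · 100 n η`, against a log-moment `32 n η`;
  -- the margin `47/4` exceeds 3.
  have hmain : ∀ e : ℝ, |e| = 1 → (Measure.pi fun _ : Fin n => μ) {x | ∃ v, ‖v‖ ≤ 1 ∧
      ∀ u ∈ Metric.ball v (1 / 4), 7 / 16 * (100 * (n * η)) ≤
        ∑ k, e * t * (inner ℝ u (x k - mean μ) ^ 2 - q u)} ≤ ENNReal.ofReal (Real.exp (-s)) := by
    intro e he
    refine (measure_exists_forall_ball_le (d := d) (Measure.pi fun _ : Fin n => μ)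
      (fun x u => ∑ k, e * t * (inner ℝ u (x k - mean μ) ^ 2 - q u)) ?_ (n * (32 * η))
      (7 / 16 * (100 * (n * η))) ?_).trans (ENNReal.ofReal_le_ofReal (eight_pow_mul_exp_le d ?_))
    · simp only [Function.uncurry_def]
      fun_prop
    · intro u hu
      rw [lintegral_exp_sum_pi μ (f := fun x => e * t * (inner ℝ u (x - mean μ) ^ 2 - q u))
        (by fun_prop), Real.exp_nat_mul, ENNReal.ofReal_pow (Real.exp_nonneg _)]
      gcongr
      have hVc : ((Real.toNNReal V : NNReal) : ℝ) = V := Real.coe_toNNReal _ hV.le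
      have het : |e * t| = t := by rw [abs_mul, he, one_mul, abs_of_pos ht0]
      have := lintegral_exp_mul_sq_sub_le (Z := fun x => inner ℝ u (x - mean μ)) (t := e * t)
        (by fun_prop) (Real.toNNReal_pos.2 hV) (h.hasSubgaussianMGF hC0.le hC hu)
        (by rw [het, hVc]; exact ht1)
      rw [integral_inner_sub_mean_sq h.memLp_id, hVc, ← sq_abs (e * t), het] at this
      refine this.trans (ENNReal.ofReal_le_ofReal (Real.exp_le_exp.2 ?_))
      calc 2048 * V ^ 2 * t ^ 2 ≤ 2048 * V ^ 2 * ((1 / (8 * V)) ^ 2 * η) := by gcongr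
        _ = 32 * η := by field_simp; norm_num
    · have : n * (32 * η) - 7 / 16 * (100 * (n * η)) = -(47 / 4) * (n * η) := by ring
      rw [this, hnη]
      have : (0 : ℝ) ≤ d := Nat.cast_nonneg d
      nlinarith
  refine (measure_mono ?_).trans ((measure_union_le _ _).trans
    (add_le_add (hmain 1 (by simp)) (hmain (-1) (by simp))))
  intro x hx
  rw [Set.mem_ofPred_eq, not_le] at hx
  set M := toEuclideanCLM (𝕜 := ℝ) (momentMatrix (mean μ) x - covMatrix μ) with hM
  have hbound : 7 / 16 * (100 * (n * η)) ≤ n * t * (7 / 16 * ‖M‖) := by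
    calc 7 / 16 * (100 * (n * η)) = n * (7 / 16 * (800 * V * (1 / (8 * V) * η))) := by
          field_simp; norm_num
      _ = n * t * (7 / 16 * (800 * V * max √η η)) := by rw [← htη]; ring
      _ ≤ _ := by gcongr
  obtain ⟨v, hv, hvu | hvu⟩ := exists_forall_ball_le_quadratic M (inner_toEuclideanCLM_left
    ((momentMatrix_isHermitian (mean μ) x).sub covMatrix_isHermitian))
  · refine Or.inl ⟨v, hv, fun u hu => hbound.trans ?_⟩
    rw [hsum, one_mul]
    gcongr
    exact hvu u hu
  · refine Or.inr ⟨v, hv, fun u hu => hbound.trans ?_⟩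
    rw [hsum, neg_one_mul]
    gcongr
    exact hvu u hu

/-- Concentration of the sample mean and of the sample covariance in operator norm. -/
theorem exists_forall_measure_deviation_le (hK : 0 < K) (hC0 : 0 < C) :
    ∃ κ > 0, ∀ (d n : ℕ) (μ : Measure (EuclideanSpace ℝ (Fin d))) [IsProbabilityMeasure μ],
      IsSubGaussian K μ → lambdaMax (covMatrix μ) ≤ C → 1 ≤ d → n ≠ 0 → ∀ s : ℝ, 0 < s →
      (Measure.pi fun _ : Fin n => μ)
        {x | ¬ (‖empMean x - mean μ‖ ≤ κ * √((d + s) / n) ∧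
          ‖toEuclideanCLM (𝕜 := ℝ) (empCov x - covMatrix μ)‖ ≤
            κ * max √((d + s) / n) ((d + s) / n))} ≤ ENNReal.ofReal (3 * Real.exp (-s)) := by
  set V := 4 * K ^ 2 * C with hVdef
  have hV : 0 < V := by positivity
  refine ⟨800 * V + (V + 8) ^ 2, by positivity, ?_⟩
  intro d n μ _ h hC hd hn s hs
  have hn' : (0 : ℝ) < n := by exact_mod_cast Nat.pos_of_ne_zero hn
  have h1 := measure_empMean_deviation_le h hC0.le hC hn hs
  have h2 := measure_momentMatrix_deviation_le h hK hC0 hC hd hn hs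
  rw [← hVdef] at h1 h2
  set η := (d + s) / n with hη
  have hη0 : 0 < η := by positivity
  refine (measure_mono ?_).trans ((measure_union_le _ _).trans ((add_le_add h1 h2).trans_eq ?_))
  · intro x hx
    by_contra hcon
    rw [Set.mem_union, not_or, Set.mem_ofPred_eq, Set.mem_ofPred_eq, not_not, not_not] at hcon
    obtain ⟨ha, hb⟩ := hcon
    refine hx ⟨ha.trans ?_, (norm_empCov_sub_le hd hn covMatrix_isHermitian (mean μ) x).trans ?_⟩
    · refine mul_le_mul_of_nonneg_right ?_ (Real.sqrt_nonneg _)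
      nlinarith
    · have h3 : ‖empMean x - mean μ‖ ^ 2 ≤ (V + 8) ^ 2 * max √η η := by
        calc _ ≤ ((V + 8) * √η) ^ 2 := by gcongr
          _ = (V + 8) ^ 2 * η := by rw [mul_pow, Real.sq_sqrt hη0.le]
          _ ≤ _ := by gcongr; exact le_max_right _ _
      rw [add_mul]
      exact add_le_add hb h3
  · rw [← ENNReal.ofReal_add (Real.exp_nonneg _) (Real.exp_nonneg _),
      ← ENNReal.ofReal_add (Real.exp_nonneg _) (by positivity)]
    congr 1
    ring

end LinearMonge

/-! ### From deviations of the moments to the error of the map -/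

namespace LinearMonge

open Matrix

/-- Only bad events are transferred to the product measure, so an inequality suffices and `B` need
not be measurable. -/
theorem measure_preimage_le_pi {Ω α : Type*} [MeasurableSpace Ω] [MeasurableSpace α]
    {P : Measure Ω} [IsProbabilityMeasure P] {μ : Measure α} {n : ℕ} {X : Fin n → Ω → α}
    (hX : ∀ i, HasLaw (X i) μ P) (hind : iIndepFun X P) (B : Set (Fin n → α)) :
    P {ω | (fun i => X i ω) ∈ B} ≤ (Measure.pi fun _ => μ) B := by
  have h := (iIndepFun_iff_map_fun_eq_pi_map fun i => (hX i).aemeasurable).1 hind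
  simp only [(hX _).map_eq] at h
  rw [← h]
  exact Measure.le_map_apply (aemeasurable_pi_lambda _ fun i => (hX i).aemeasurable) B

theorem mapDist_popMap_empMap_le {d n₁ n₂ : ℕ} {μ₁ μ₂ : Measure (EuclideanSpace ℝ (Fin d))}
    [IsProbabilityMeasure μ₁] (h₁ : MemLp id 2 μ₁) (x : Fin n₁ → EuclideanSpace ℝ (Fin d))
    (y : Fin n₂ → EuclideanSpace ℝ (Fin d)) :
    mapDist μ₁ (popMap μ₁ μ₂) (empMap x y) ≤ ‖empMean y - mean μ₂‖ +
      ‖toEuclideanCLM (𝕜 := ℝ) (mongeMatrix (empCov x) (empCov y))‖ * ‖empMean x - mean μ₁‖ +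
      ‖toEuclideanCLM (𝕜 := ℝ) (mongeMatrix (empCov x) (empCov y)) -
        toEuclideanCLM (𝕜 := ℝ) (mongeMatrix (covMatrix μ₁) (covMatrix μ₂))‖ *
        √(covMatrix μ₁).trace := by
  set A := toEuclideanCLM (𝕜 := ℝ) (mongeMatrix (covMatrix μ₁) (covMatrix μ₂)) with hA
  set A' := toEuclideanCLM (𝕜 := ℝ) (mongeMatrix (empCov x) (empCov y)) with hA'
  have hi : Integrable (fun z => ‖z - mean μ₁‖) μ₁ :=
    ((h₁.integrable (by norm_num)).sub (integrable_const (mean μ₁))).norm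
  have hpt : ∀ z, ‖popMap μ₁ μ₂ z - empMap x y z‖ ≤
      (‖empMean y - mean μ₂‖ + ‖A'‖ * ‖empMean x - mean μ₁‖) + ‖A' - A‖ * ‖z - mean μ₁‖ := by
    intro z
    have e1 : popMap μ₁ μ₂ z - empMap x y z =
        -(empMean y - mean μ₂) + A' (empMean x - mean μ₁) - (A' - A) (z - mean μ₁) := by
      simp only [popMap, empMap, mongeMap, ← hA, ← hA', _root_.sub_apply, map_sub]
      abel
    rw [e1]
    refine (norm_sub_le _ _).trans (add_le_add ((norm_add_le _ _).trans ?_)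
      (ContinuousLinearMap.le_opNorm _ _))
    rw [norm_neg]
    gcongr
    exact ContinuousLinearMap.le_opNorm _ _
  unfold mapDist
  refine (integral_mono_of_nonneg (ae_of_all _ fun _ => norm_nonneg _)
    ((integrable_const _).add (hi.const_mul _)) (ae_of_all _ hpt)).trans ?_
  simp only [Pi.add_apply]
  rw [integral_add (integrable_const _) (hi.const_mul _), integral_const_mul]
  simp only [integral_const, probReal_univ, one_smul]
  gcongr
  exact integral_norm_sub_mean_le h₁

theorem abs_inner_toEuclideanCLM_sub_le {d : ℕ} {S S' : Matrix (Fin d) (Fin d) ℝ} {δ : ℝ}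
    (h : ‖toEuclideanCLM (𝕜 := ℝ) (S' - S)‖ ≤ δ) (u : EuclideanSpace ℝ (Fin d)) :
    |inner ℝ u (toEuclideanCLM (𝕜 := ℝ) S' u) - inner ℝ u (toEuclideanCLM (𝕜 := ℝ) S u)| ≤
      δ * ‖u‖ ^ 2 := by
  rw [← inner_sub_right, ← _root_.sub_apply, ← map_sub]
  calc _ ≤ ‖u‖ * ‖toEuclideanCLM (𝕜 := ℝ) (S' - S) u‖ := abs_real_inner_le_norm _ _
    _ ≤ ‖u‖ * (‖toEuclideanCLM (𝕜 := ℝ) (S' - S)‖ * ‖u‖) := by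
        gcongr; exact ContinuousLinearMap.le_opNorm _ _
    _ ≤ ‖u‖ * (δ * ‖u‖) := by gcongr
    _ = _ := by ring

/-- For large `t` the empirical target covariance need not be close to the true one, so the bound
may grow. Growth like `1 + √e` is harmless: multiplied by a mean deviation of order `√e` it gives
`√e + e`, still within the rate. -/
theorem norm_mongeMatrix_le_of_norm_sub_le {d : ℕ} {S S₁' S₂' : Matrix (Fin d) (Fin d) ℝ}
    {C κ b η e : ℝ} (hC : 0 < C) (hκ : 0 < κ) (hb : 0 < b) (he0 : 0 ≤ e) (hηe : η ≤ e)
    (h₁ : S₁'.PosDef) (h₂ : S₂'.PosSemidef)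
    (hS : ∀ u, inner ℝ u (toEuclideanCLM (𝕜 := ℝ) S u) ≤ C * ‖u‖ ^ 2)
    (hS₁ : ∀ u, b * ‖u‖ ^ 2 ≤ inner ℝ u (toEuclideanCLM (𝕜 := ℝ) S₁' u))
    (hS₂ : ‖toEuclideanCLM (𝕜 := ℝ) (S₂' - S)‖ ≤ κ * max √η η) :
    ‖toEuclideanCLM (𝕜 := ℝ) (mongeMatrix S₁' S₂')‖ ≤ √((C + κ) / b) * (1 + √e) := by
  have hsq : √e * √e = e := Real.mul_self_sqrt he0
  have hse := Real.sqrt_nonneg e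
  have h5 : max √η η ≤ (1 + √e) ^ 2 := by
    have h7 : √η ≤ √e := Real.sqrt_le_sqrt hηe
    refine max_le ?_ ?_ <;> nlinarith
  have h8 : C ≤ C * (1 + √e) ^ 2 := le_mul_of_one_le_right hC.le (by nlinarith)
  have h9 : κ * max √η η ≤ κ * (1 + √e) ^ 2 := mul_le_mul_of_nonneg_left h5 hκ.le
  have hy : ∀ u, inner ℝ u (toEuclideanCLM (𝕜 := ℝ) S₂' u) ≤
      (C + κ) * (1 + √e) ^ 2 * ‖u‖ ^ 2 := fun u => by
    have h3 := (abs_le.1 (abs_inner_toEuclideanCLM_sub_le hS₂ u)).2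
    have h10 := mul_le_mul_of_nonneg_right (add_le_add h8 h9) (sq_nonneg ‖u‖)
    linarith [hS u]
  refine (norm_mongeMatrix_le h₁ h₂ hb hS₁ hy).trans_eq ?_
  rw [mul_div_right_comm, Real.sqrt_mul (by positivity), Real.sqrt_sq (by positivity)]

/-- The error of the empirical Monge map, in terms of deviations `κ √η` of the sample means and
`κ max (√η) η` of the sample covariances. -/
theorem mapDist_le_of_deviation {d n₁ n₂ : ℕ} {μ₁ μ₂ : Measure (EuclideanSpace ℝ (Fin d))}
    [IsProbabilityMeasure μ₁] (h₁ : MemLp id 2 μ₁)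
    {c C κ η₁ η₂ θ r : ℝ} (hc : 0 < c) (hC : 0 < C) (hκ : 0 < κ) (hd : 1 ≤ d)
    (hc₁ : c ≤ lambdaMin (covMatrix μ₁)) (hc₂ : c ≤ lambdaMin (covMatrix μ₂))
    (hC₁ : lambdaMax (covMatrix μ₁) ≤ C) (hC₂ : lambdaMax (covMatrix μ₂) ≤ C)
    (hη₁ : 0 ≤ η₁)
    (hθ₁ : η₁ ≤ θ) (hθ₂ : η₂ ≤ θ) (hsθ₁ : √η₁ ≤ θ) (hsθ₂ : √η₂ ≤ θ)
    (hr : c / C ≤ r) (htr : (covMatrix μ₁).trace ≤ C * r)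
    (x : Fin n₁ → EuclideanSpace ℝ (Fin d)) (y : Fin n₂ → EuclideanSpace ℝ (Fin d))
    (hx : ∀ u, c / 2 * ‖u‖ ^ 2 ≤ inner ℝ u (toEuclideanCLM (𝕜 := ℝ) (empCov x) u))
    (hmx : ‖empMean x - mean μ₁‖ ≤ κ * √η₁)
    (hSx : ‖toEuclideanCLM (𝕜 := ℝ) (empCov x - covMatrix μ₁)‖ ≤ κ * max √η₁ η₁)
    (hmy : ‖empMean y - mean μ₂‖ ≤ κ * √η₂)
    (hSy : ‖toEuclideanCLM (𝕜 := ℝ) (empCov y - covMatrix μ₂)‖ ≤ κ * max √η₂ η₂) :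
    mapDist μ₁ (popMap μ₁ μ₂) (empMap x y) ≤
      κ * ((1 + 2 * √((C + κ) / (c / 2))) * √(C / c) +
        (1 + C / c) / (√(c / C) * (c / 2)) * √C) * θ * √r := by
  set L := (1 + C / c) / (√(c / C) * (c / 2)) with hL
  set D := √((C + κ) / (c / 2)) with hD
  have hL0 : 0 < L := by positivity
  have hD0 : 0 ≤ D := Real.sqrt_nonneg _
  have hθ0 : 0 ≤ θ := hη₁.trans hθ₁
  have hr0 : 0 ≤ r := (by positivity : 0 ≤ c / C).trans hr
  have hlow : ∀ {μ : Measure (EuclideanSpace ℝ (Fin d))}, c ≤ lambdaMin (covMatrix μ) →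
      ∀ u, c * ‖u‖ ^ 2 ≤ inner ℝ u (toEuclideanCLM (𝕜 := ℝ) (covMatrix μ) u) := fun h u =>
    (mul_le_mul_of_nonneg_right h (sq_nonneg _)).trans (lambdaMin_mul_le covMatrix_isHermitian u)
  have hup : ∀ {μ : Measure (EuclideanSpace ℝ (Fin d))}, lambdaMax (covMatrix μ) ≤ C →
      ∀ u, inner ℝ u (toEuclideanCLM (𝕜 := ℝ) (covMatrix μ) u) ≤ C * ‖u‖ ^ 2 := fun h u =>
    (le_lambdaMax_mul covMatrix_isHermitian u).trans (mul_le_mul_of_nonneg_right h (sq_nonneg _))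
  have hpx : (empCov x).PosDef :=
    posDef_of_le_inner (momentMatrix_isHermitian _ x) (by positivity) hx
  have hpy : (empCov y).PosSemidef := momentMatrix_posSemidef _ y
  have hp₁ := posDef_of_le_inner covMatrix_isHermitian hc (hlow hc₁)
  have hp₂ := (posDef_of_le_inner covMatrix_isHermitian hc (hlow hc₂)).posSemidef
  have hpert : ‖toEuclideanCLM (𝕜 := ℝ) (mongeMatrix (empCov x) (empCov y)) -
      toEuclideanCLM (𝕜 := ℝ) (mongeMatrix (covMatrix μ₁) (covMatrix μ₂))‖ ≤ L * (κ * θ) := by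
    refine (norm_mongeMatrix_sub_le hd hc hC (half_pos hc) hp₁ hp₂ hpx hpy (hlow hc₁) (hup hC₁)
      (hlow hc₂) (hup hC₂) hx (δ := κ * θ) (hSx.trans ?_) (hSy.trans ?_)).trans_eq ?_
    · gcongr; exact max_le hsθ₁ hθ₁
    · gcongr; exact max_le hsθ₂ hθ₂
    · rw [hL]; ring
  set e := max η₁ η₂ with he
  have he0 : 0 ≤ e := hη₁.trans (le_max_left _ _)
  have heθ : e ≤ θ := max_le hθ₁ hθ₂
  have hseθ : √e ≤ θ := by
    rcases max_choice η₁ η₂ with h | h <;> rw [he, h] <;> assumption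
  have hsq : √e * √e = e := Real.mul_self_sqrt he0
  have hA' : ‖toEuclideanCLM (𝕜 := ℝ) (mongeMatrix (empCov x) (empCov y))‖ ≤ D * (1 + √e) :=
    norm_mongeMatrix_le_of_norm_sub_le hC hκ (half_pos hc) he0 (le_max_right _ _) hpx hpy
      (hup hC₂) hx hSy
  have hmx' : ‖empMean x - mean μ₁‖ ≤ κ * √e :=
    hmx.trans (mul_le_mul_of_nonneg_left (Real.sqrt_le_sqrt (le_max_left _ _)) hκ.le)
  have hmy' : ‖empMean y - mean μ₂‖ ≤ κ * θ := hmy.trans (mul_le_mul_of_nonneg_left hsθ₂ hκ.le)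
  have htr' : √(covMatrix μ₁).trace ≤ √C * √r := by
    rw [← Real.sqrt_mul hC.le]
    exact Real.sqrt_le_sqrt htr
  -- The mean errors come without the factor `√r`; as `r ≥ c / C`, it can be inserted at the cost of
  -- a constant.
  have hone : 1 ≤ √(C / c) * √r := by
    rw [← Real.sqrt_mul (by positivity)]
    refine Real.one_le_sqrt.2 ?_
    calc (1 : ℝ) = C / c * (c / C) := by field_simp
      _ ≤ _ := by gcongr
  refine (mapDist_popMap_empMap_le h₁ x y).trans ((add_le_add (add_le_add hmy'
    (mul_le_mul hA' hmx' (norm_nonneg _) (by positivity)))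
    (mul_le_mul hpert htr' (Real.sqrt_nonneg _) (by positivity))).trans ?_)
  calc κ * θ + D * (1 + √e) * (κ * √e) + L * (κ * θ) * (√C * √r)
      = κ * θ + κ * D * (√e + √e * √e) + L * (κ * θ) * (√C * √r) := by ring
    _ ≤ κ * θ + κ * D * (θ + θ) + L * (κ * θ) * (√C * √r) := by rw [hsq]; gcongr
    _ = κ * (1 + 2 * D) * θ * 1 + κ * (L * √C) * θ * √r := by ring
    _ ≤ κ * (1 + 2 * D) * θ * (√(C / c) * √r) + κ * (L * √C) * θ * √r := by gcongr
    _ = _ := by ring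

/-- The trace is at least `d c`, so the effective rank is at least a fixed fraction of `d`: bounds
in terms of `d` become bounds in terms of effective rank. -/
theorem effRank_bounds {d : ℕ} (hd : 1 ≤ d) {S : Matrix (Fin d) (Fin d) ℝ} (hS : S.IsHermitian)
    {c C : ℝ} (hc : 0 < c) (hc' : c ≤ lambdaMin S) (hC : lambdaMax S ≤ C) :
    d * (c / C) ≤ effRank S ∧ S.trace ≤ C * effRank S := by
  have h1 := lambdaMin_le_lambdaMax hd hS
  have h2 : 0 < lambdaMax S := by linarith
  have h3 : (d : ℝ) * c ≤ S.trace :=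
    (mul_le_mul_of_nonneg_left hc' (Nat.cast_nonneg d)).trans (lambdaMin_mul_le_trace hS)
  have h4 : S.trace = lambdaMax S * effRank S := by
    rw [effRank]; field_simp
  have h5 : 0 ≤ effRank S := div_nonneg (le_trans (by positivity) h3) h2.le
  refine ⟨?_, h4.trans_le (by gcongr)⟩
  rw [← mul_div_assoc, div_le_iff₀ (h2.trans_le hC)]
  nlinarith

/-- From `exp x ≥ x² / 2` at `x = ε n`, together with `ε² n ≥ 6`. -/
theorem three_mul_exp_neg_le {ε n : ℝ} (hε : 0 < ε) (hn : 6 / ε ^ 2 ≤ n) :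
    3 * Real.exp (-(ε * n)) ≤ 1 / n := by
  have hn0 : 0 < n := lt_of_lt_of_le (by positivity) hn
  have h1 := Real.quadratic_le_exp_of_nonneg (x := ε * n) (by positivity)
  have h2 : 6 ≤ n * ε ^ 2 := (div_le_iff₀ (by positivity)).1 hn
  have h3 : 3 * n ≤ Real.exp (ε * n) := by nlinarith [mul_pos hε hn0]
  rw [Real.exp_neg, ← div_eq_mul_inv, div_le_div_iff₀ (Real.exp_pos _) hn0]
  linarith

end LinearMonge

/-! ### Effective-rank rates and the union bound -/

namespace LinearMonge

open Matrix

/-- Since `log 6 ≤ 5 ≤ 5 d`, one has `d + log 6 ≤ 6 d ≤ 6 (C / c) r`. The condition `r ≤ n` puts `r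
/ n` below its square root, whereas `t / N` may be large and must be bounded separately. -/
theorem deviation_rate_le {d : ℕ} {n N r t c C M : ℝ} (hd : 1 ≤ d) (hc : 0 < c) (hcC : c ≤ C)
    (hr : d * (c / C) ≤ r) (hrn : r ≤ n) (hN : 0 < N) (hNn : N ≤ n) (ht : 0 < t)
    (h₁ : √(r / n) ≤ M) (h₂ : √(t / N) ≤ M) (h₃ : t / N ≤ M) :
    (d + (t + Real.log 6)) / n ≤ (6 * (C / c) + 1) * M ∧
      √((d + (t + Real.log 6)) / n) ≤ (6 * (C / c) + 1) * M := by
  have hC : 0 < C := hc.trans_le hcC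
  have hn : 0 < n := hN.trans_le hNn
  have hd' : (1 : ℝ) ≤ d := by exact_mod_cast hd
  have hr0 : 0 ≤ r := le_trans (by positivity) hr
  have hlog : Real.log 6 ≤ 5 := by
    have := Real.log_le_sub_one_of_pos (x := 6) (by norm_num)
    linarith
  have hk : 1 ≤ 6 * (C / c) := by
    have := (one_le_div hc).2 hcC
    linarith
  have hdr : (d : ℝ) ≤ C / c * r := by
    calc (d : ℝ) = C / c * (d * (c / C)) := by field_simp
      _ ≤ _ := by gcongr
  have hη : (d + (t + Real.log 6)) / n ≤ 6 * (C / c) * (r / n) + t / N := by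
    calc (d + (t + Real.log 6)) / n ≤ (6 * (C / c) * r + t) / n := by
          refine div_le_div_of_nonneg_right ?_ hn.le
          linarith
      _ = 6 * (C / c) * (r / n) + t / n := by ring
      _ ≤ _ := by gcongr
  have hrn1 : r / n ≤ √(r / n) := by
    refine Real.le_sqrt_of_sq_le ?_
    have h0 : 0 ≤ r / n := by positivity
    have h1 : r / n ≤ 1 := (div_le_one hn).2 hrn
    nlinarith
  refine ⟨hη.trans ?_, (Real.sqrt_le_sqrt hη).trans ?_⟩
  · rw [add_mul, one_mul]
    gcongr
    exact hrn1.trans h₁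
  · have hadd : ∀ a b : ℝ, 0 ≤ a → 0 ≤ b → √(a + b) ≤ √a + √b := fun a b ha hb =>
      Real.sqrt_le_iff.2 ⟨by positivity, by
        nlinarith [Real.sq_sqrt ha, Real.sq_sqrt hb, Real.sqrt_nonneg a, Real.sqrt_nonneg b]⟩
    refine (hadd _ _ (by positivity) (by positivity)).trans ?_
    rw [add_mul, one_mul, Real.sqrt_mul (by positivity)]
    gcongr
    exact Real.sqrt_le_iff.2 ⟨by positivity, by nlinarith⟩

/-- On the event that the sample means and covariances are close to their population versions,
the empirical Monge map is close to the population one. -/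
theorem posDef_and_mapDist_le_of_deviation {d n₁ n₂ : ℕ}
    {μ₁ μ₂ : Measure (EuclideanSpace ℝ (Fin d))} [IsProbabilityMeasure μ₁] (h₁ : MemLp id 2 μ₁)
    {c C κ r₁ r₂ t : ℝ} (hc : 0 < c) (hcC : c ≤ C) (hκ : 0 < κ) (hd : 1 ≤ d) (ht : 0 < t)
    (hc₁ : c ≤ lambdaMin (covMatrix μ₁)) (hc₂ : c ≤ lambdaMin (covMatrix μ₂))
    (hC₁ : lambdaMax (covMatrix μ₁) ≤ C) (hC₂ : lambdaMax (covMatrix μ₂) ≤ C)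
    (hr₁ : d * (c / C) ≤ r₁) (hr₂ : d * (c / C) ≤ r₂) (htr₁ : (covMatrix μ₁).trace ≤ C * r₁)
    (hrn₁ : r₁ ≤ n₁) (hrn₂ : r₂ ≤ n₂) (hn₁ : (0 : ℝ) < n₁) (hn₂ : (0 : ℝ) < n₂)
    (x : Fin n₁ → EuclideanSpace ℝ (Fin d)) (y : Fin n₂ → EuclideanSpace ℝ (Fin d))
    (h₀ : ‖toEuclideanCLM (𝕜 := ℝ) (empCov x - covMatrix μ₁)‖ ≤ c / 2)
    (hmx : ‖empMean x - mean μ₁‖ ≤ κ * √((d + (t + Real.log 6)) / n₁))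
    (hSx : ‖toEuclideanCLM (𝕜 := ℝ) (empCov x - covMatrix μ₁)‖ ≤
      κ * max √((d + (t + Real.log 6)) / n₁) ((d + (t + Real.log 6)) / n₁))
    (hmy : ‖empMean y - mean μ₂‖ ≤ κ * √((d + (t + Real.log 6)) / n₂))
    (hSy : ‖toEuclideanCLM (𝕜 := ℝ) (empCov y - covMatrix μ₂)‖ ≤
      κ * max √((d + (t + Real.log 6)) / n₂) ((d + (t + Real.log 6)) / n₂)) :
    (empCov x).PosDef ∧ mapDist μ₁ (popMap μ₁ μ₂) (empMap x y) ≤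
      κ * ((1 + 2 * √((C + κ) / (c / 2))) * √(C / c) +
        (1 + C / c) / (√(c / C) * (c / 2)) * √C) * (6 * (C / c) + 1) *
        max (max (max √(r₁ / n₁) √(r₂ / n₂)) √(t / min (n₁ : ℝ) (n₂ : ℝ)))
          (t / min (n₁ : ℝ) (n₂ : ℝ)) * √r₁ := by
  have hd' : (1 : ℝ) ≤ d := by exact_mod_cast hd
  have hC : 0 < C := hc.trans_le hcC
  have hx : ∀ u, c / 2 * ‖u‖ ^ 2 ≤ inner ℝ u (toEuclideanCLM (𝕜 := ℝ) (empCov x) u) := fun u => by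
    have h3 := (abs_le.1 (abs_inner_toEuclideanCLM_sub_le h₀ u)).1
    have h4 := lambdaMin_mul_le (covMatrix_isHermitian (μ := μ₁)) u
    have h5 := mul_le_mul_of_nonneg_right hc₁ (sq_nonneg ‖u‖)
    linarith
  refine ⟨posDef_of_le_inner (momentMatrix_isHermitian _ _) (half_pos hc) hx, ?_⟩
  set N := min (n₁ : ℝ) (n₂ : ℝ) with hN
  have hN0 : 0 < N := lt_min hn₁ hn₂
  set M := max (max (max √(r₁ / n₁) √(r₂ / n₂)) √(t / N)) (t / N) with hM
  have hM₃ : √(t / N) ≤ M := (le_max_right _ _).trans (le_max_left _ _)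
  have hM₁ : √(r₁ / n₁) ≤ M :=
    (le_max_left _ _).trans ((le_max_left _ _).trans (le_max_left _ _))
  have hM₂ : √(r₂ / n₂) ≤ M :=
    (le_max_right _ _).trans ((le_max_left _ _).trans (le_max_left _ _))
  obtain ⟨e1, e2⟩ := deviation_rate_le hd hc hcC hr₁ hrn₁ hN0 (min_le_left _ _) ht hM₁ hM₃
    (le_max_right _ _)
  obtain ⟨e3, e4⟩ := deviation_rate_le hd hc hcC hr₂ hrn₂ hN0 (min_le_right _ _) ht hM₂ hM₃
    (le_max_right _ _)
  have hlog : 0 < Real.log 6 := Real.log_pos (by norm_num)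
  exact (mapDist_le_of_deviation h₁ hc hC hκ hd hc₁ hc₂ hC₁ hC₂
    (by positivity) e1 e3 e2 e4 ((le_mul_of_one_le_left (by positivity) hd').trans hr₁) htr₁ _ _
    hx hmx hSx hmy hSy).trans_eq (by ring)

/-- Subadditivity on a cover of the whole space, which requires no measurability of the good event.
-/
theorem one_sub_sub_le_measureReal {Ω : Type*} [MeasurableSpace Ω] {P : Measure Ω}
    [IsProbabilityMeasure P] {G B₀ B₁ B₂ : Set Ω} {a b : ℝ} (ha : 0 ≤ a) (hb : 0 ≤ b)
    (h₀ : P B₀ ≤ ENNReal.ofReal a) (h₁ : P B₁ ≤ ENNReal.ofReal (b / 2))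
    (h₂ : P B₂ ≤ ENNReal.ofReal (b / 2)) (h : ∀ ω, ω ∉ B₀ → ω ∉ B₁ → ω ∉ B₂ → ω ∈ G) :
    1 - b - a ≤ P.real G := by
  have h₀' := ENNReal.toReal_le_of_le_ofReal ha h₀
  have h₁' := ENNReal.toReal_le_of_le_ofReal (div_nonneg hb zero_le_two) h₁
  have h₂' := ENNReal.toReal_le_of_le_ofReal (div_nonneg hb zero_le_two) h₂
  rw [← measureReal_def] at h₀' h₁' h₂'
  have hcover : Set.univ ⊆ G ∪ (B₀ ∪ (B₁ ∪ B₂)) := fun ω _ => by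
    have := h ω
    simp only [Set.mem_union]
    tauto
  have h3 := measureReal_mono (μ := P) hcover
  rw [probReal_univ] at h3
  have h4 := measureReal_union_le (μ := P) G (B₀ ∪ (B₁ ∪ B₂))
  have h5 := measureReal_union_le (μ := P) B₀ (B₁ ∪ B₂)
  have h6 := measureReal_union_le (μ := P) B₁ B₂
  linarith

end LinearMonge

open LinearMonge in
theorem theorem1 (c C K : ℝ) (hc : 0 < c) (hcC : c ≤ C) (hK : 0 < K) :
    ∃ C' > (0 : ℝ), ∃ C'' > (0 : ℝ),
      ∀ (d n₁ n₂ : ℕ) (μ₁ μ₂ : Measure (EuclideanSpace ℝ (Fin d)))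
        [IsProbabilityMeasure μ₁] [IsProbabilityMeasure μ₂],
        1 ≤ d →
        LinearMonge.IsSubGaussian K μ₁ → LinearMonge.IsSubGaussian K μ₂ →
        c < min (LinearMonge.lambdaMin (LinearMonge.covMatrix μ₁))
          (LinearMonge.lambdaMin (LinearMonge.covMatrix μ₂)) →
        max (LinearMonge.lambdaMax (LinearMonge.covMatrix μ₁))
          (LinearMonge.lambdaMax (LinearMonge.covMatrix μ₂)) ≤ C →
        d ≤ n₁ →
        C' * LinearMonge.effRank (LinearMonge.covMatrix μ₁) ≤ (n₁ : ℝ) →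
        C' * LinearMonge.effRank (LinearMonge.covMatrix μ₂) ≤ (n₂ : ℝ) →
        ∀ (Ω : Type*) [MeasurableSpace Ω] (P : Measure Ω) [IsProbabilityMeasure P]
          (X : Fin n₁ → Ω → EuclideanSpace ℝ (Fin d))
          (Y : Fin n₂ → Ω → EuclideanSpace ℝ (Fin d)),
          (∀ i, HasLaw (X i) μ₁ P) → iIndepFun X P →
          (∀ j, HasLaw (Y j) μ₂ P) → iIndepFun Y P →
          ∀ t : ℝ, 0 < t →
            1 - Real.exp (-t) - 1 / (n₁ : ℝ) ≤
              P.real {ω |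
                (LinearMonge.empCov (fun i => X i ω)).PosDef ∧
                LinearMonge.mapDist μ₁ (LinearMonge.popMap μ₁ μ₂)
                    (LinearMonge.empMap (fun i => X i ω) (fun j => Y j ω)) ≤
                  C'' *
                    max (max (max
                      (√(LinearMonge.effRank (LinearMonge.covMatrix μ₁) / n₁))
                      (√(LinearMonge.effRank (LinearMonge.covMatrix μ₂) / n₂)))
                      (√(t / min (n₁ : ℝ) (n₂ : ℝ))))
                      (t / min (n₁ : ℝ) (n₂ : ℝ)) *
                    √(LinearMonge.effRank (LinearMonge.covMatrix μ₁))} := by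
  have hC : 0 < C := hc.trans_le hcC
  obtain ⟨κ, hκ, hconc⟩ := exists_forall_measure_deviation_le (K := K) hK hC
  -- `2 ε ≤ 1` makes the square root the larger of the two deviations at `s = ε n₁`; `2 ε ≤ (c /
  -- (2κ))²` makes that deviation at most `c / 2`.
  set ε := min (1 / 2) (c ^ 2 / (8 * κ ^ 2)) with hε
  have hε0 : 0 < ε := by positivity
  have hε1 : ε ≤ 1 / 2 := min_le_left _ _
  have hε2 : ε ≤ c ^ 2 / (8 * κ ^ 2) := min_le_right _ _
  have h6ε : 1 / ε ≤ 6 / ε ^ 2 := by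
    rw [div_le_div_iff₀ hε0 (by positivity)]
    nlinarith
  -- The factor `C / c` turns effective rank into dimension, so that `n ≥ (6 / ε²) d`. This yields
  -- both `d ≤ ε n₁` and the size needed for `3 exp (-ε n₁) ≤ 1 / n₁`.
  refine ⟨C / c * (6 / ε ^ 2), by positivity,
    κ * ((1 + 2 * √((C + κ) / (c / 2))) * √(C / c) +
      (1 + C / c) / (√(c / C) * (c / 2)) * √C) * (6 * (C / c) + 1), by positivity, ?_⟩
  intro d n₁ n₂ μ₁ μ₂ _ _ hd hsub₁ hsub₂ hmin hmax _ hn₁ hn₂ Ω _ P _ X Y hX hXi hY hYi t ht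
  obtain ⟨hc₁, hc₂⟩ := lt_min_iff.1 hmin
  obtain ⟨hC₁, hC₂⟩ := max_le_iff.1 hmax
  obtain ⟨hr₁, htr₁⟩ := effRank_bounds hd covMatrix_isHermitian hc hc₁.le hC₁
  obtain ⟨hr₂, -⟩ := effRank_bounds hd covMatrix_isHermitian hc hc₂.le hC₂
  have hd' : (1 : ℝ) ≤ d := by exact_mod_cast hd
  have hsize : ∀ {r n : ℝ}, d * (c / C) ≤ r → C / c * (6 / ε ^ 2) * r ≤ n →
      6 / ε ^ 2 * d ≤ n ∧ r ≤ n := by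
    intro r n hr hn
    have hr0 : 0 ≤ r := le_trans (by positivity) hr
    constructor
    · calc 6 / ε ^ 2 * d = C / c * (6 / ε ^ 2) * (d * (c / C)) := by field_simp
        _ ≤ C / c * (6 / ε ^ 2) * r := by gcongr
        _ ≤ n := hn
    · refine le_trans (le_mul_of_one_le_left hr0 ?_) hn
      have h1 : 1 ≤ C / c := (one_le_div hc).2 hcC
      have h2 : 1 ≤ 1 / ε := (one_le_div hε0).2 (by linarith)
      nlinarith
  obtain ⟨hdn₁, hrn₁⟩ := hsize hr₁ hn₁
  obtain ⟨hdn₂, hrn₂⟩ := hsize hr₂ hn₂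
  have hn₁' : (0 : ℝ) < n₁ := lt_of_lt_of_le (by positivity) hdn₁
  have hn₂' : (0 : ℝ) < n₂ := lt_of_lt_of_le (by positivity) hdn₂
  have hn₁0 : n₁ ≠ 0 := by exact_mod_cast hn₁'.ne'
  have hn₂0 : n₂ ≠ 0 := by exact_mod_cast hn₂'.ne'
  have h6n : 6 / ε ^ 2 ≤ n₁ := (le_mul_of_one_le_right (by positivity) hd').trans hdn₁
  have hlog : 0 < Real.log 6 := Real.log_pos (by norm_num)
  have hs0 : 0 < t + Real.log 6 := by positivity
  have hexp : 3 * Real.exp (-(t + Real.log 6)) = Real.exp (-t) / 2 := by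
    rw [neg_add, Real.exp_add, Real.exp_neg (Real.log 6), Real.exp_log (by norm_num)]
    ring
  have hη₀ : (d + ε * n₁) / n₁ ≤ 2 * ε := by
    rw [div_le_iff₀ hn₁']
    have h4 : 1 / ε * d ≤ n₁ := le_trans (by gcongr) hdn₁
    rw [one_div_mul_eq_div, div_le_iff₀ hε0] at h4
    linarith
  have hdev : κ * max √((d + ε * n₁) / n₁) ((d + ε * n₁) / n₁) ≤ c / 2 := by
    have hη0 : 0 ≤ (d + ε * n₁) / n₁ := by positivity
    have hη1 : (d + ε * n₁) / n₁ ≤ √((d + ε * n₁) / n₁) := Real.le_sqrt_of_sq_le (by nlinarith)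
    rw [max_eq_left hη1, ← le_div_iff₀' hκ]
    refine Real.sqrt_le_iff.2 ⟨by positivity, hη₀.trans ?_⟩
    calc 2 * ε ≤ 2 * (c ^ 2 / (8 * κ ^ 2)) := by gcongr
      _ = _ := by field_simp; norm_num
  -- Conditioning of the first sample costs `1 / n₁` whatever `t` is; the other two events cost `exp
  -- (-t) / 2` each, by the choice of `log 6`.
  have hP₀ := (measure_preimage_le_pi hX hXi _).trans ((hconc d n₁ μ₁ hsub₁ hC₁ hd hn₁0 (ε * n₁)
    (by positivity)).trans (ENNReal.ofReal_le_ofReal (three_mul_exp_neg_le hε0 h6n)))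
  have hP₁ := (measure_preimage_le_pi hX hXi _).trans
    (hconc d n₁ μ₁ hsub₁ hC₁ hd hn₁0 (t + Real.log 6) hs0)
  have hP₂ := (measure_preimage_le_pi hY hYi _).trans
    (hconc d n₂ μ₂ hsub₂ hC₂ hd hn₂0 (t + Real.log 6) hs0)
  rw [hexp] at hP₁ hP₂
  refine one_sub_sub_le_measureReal (by positivity) (Real.exp_nonneg _) hP₀ hP₁ hP₂
    fun ω h₀ h₁ h₂ => ?_
  obtain ⟨-, h₀⟩ := not_not.1 h₀
  obtain ⟨hmx, hSx⟩ := not_not.1 h₁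
  obtain ⟨hmy, hSy⟩ := not_not.1 h₂
  exact posDef_and_mapDist_le_of_deviation hsub₁.memLp_id hc hcC hκ hd ht hc₁.le hc₂.le hC₁ hC₂
    hr₁ hr₂ htr₁ hrn₁ hrn₂ hn₁' hn₂' _ _ (h₀.trans hdev) hmx hSx hmy hSy
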